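/- Fix a countably infinite set of variables, and a special name $*$ that is not a variable. **Calculus.** Terms are $t,u ::= x \mid \lambda x.t \mid tu$, and values are variables and abstractions. Right v-contexts are $R ::= \langle\cdot\rangle \mid tR \mid Rv$, where $t$ is a term and $v$ a value. Bites are $b ::= xy \mid \lambda x.[*\leftarrow y] \mid \lambda x.c$, where $c$ is a crumble; the bites of the last two forms are the crumbled values. An environment is a sequence $E$ of entries $[z\leftarrow b]$, and a crumble is an environment $[*\leftarrow b]E$ in which $*$ is assigned only in the leftmost entry. A v-environment $E_v$ has only crumbled values in its entries, and $E_v(x)$ is the bite that it assigns to $x$. The domain $\mathrm{dom}(E)$ is the list of names assigned by the entries of $E$ (not those inside bites). Free variables are given by $\mathrm{fv}(\epsilon)=\emptyset$, $\mathrm{fv}(E[z\leftarrow b])=(\mathrm{fv}(E)\setminus\{z\})\cup\mathrm{fv}(b)$, $\mathrm{fv}(xy)=\{x,y\}$, $\mathrm{fv}(\lambda x.[*\leftarrow y])=\{y\}\setminus\{x\}$, $\mathrm{fv}(\lambda x.c)=\mathrm{fv}(c)\setminus\{x\}$. The bound variables $\mathrm{bv}(E)$ are the variables bound by the abstractions that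 occur in $E$, at any depth. The bodies occurring in $E$ are the $[*\leftarrow y]$ and the $c$ of the abstractions $\lambda x.[*\leftarrow y]$ and $\lambda x.c$ that occur in $E$, at any depth. A crumble $E$ is *well-named* if the names in $\mathrm{dom}(E)$ are pairwise distinct, $\mathrm{dom}(E)\cap\mathrm{bv}(E)=\emptyset$, and $z\notin\mathrm{fv}(b)\cup\mathrm{fv}(E_2)$ whenever $E=E_1[z\leftarrow b]E_2$. Substitutions $\{x\leftarrow\cdot\}$ are capture-avoiding. **Crumbling.** The crumbling $\underline t$ of a term $t$ that is not a variable is given, for $u,u'$ not variables with $\underline u=[*\leftarrow b]E$ and $\underline{u'}=[*\leftarrow b']E'$, by $$\underline{xy}=[*\leftarrow xy],\qquad \underline{\lambda x.y}=[*\leftarrow\lambda x.[*\leftarrow y]],\qquad \underline{\lambda x.u}=[*\leftarrow\lambda x.\underline u],$$ $$\underline{uy}=[*\leftarrow xy][x\leftarrow b]E,\qquad \underline{xu'}=[*\leftarrow xy][y\leftarrow b']E',\qquad \underline{uu'}=[*\leftarrow xy][x\leftarrow b]E[y\leftarrow b']E',$$ where the introduced variables ($x$, $y$ and $x,y$ in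 the last three equations) are globally fresh: pairwise distinct in the whole translation, and not occurring in $t$. The choice of the fresh variables is arbitrary. **Reduction.** $\to_{Cr}$ is the union of the following rules, in which $E_v$ is a v-environment and $z$ may be $*$: - $E[z\leftarrow xy]E_v\to_{m_1} E[z\leftarrow b']E'E_v$ if $E_v(x)=\lambda x_1.c$ and $c^\alpha\{x_1\leftarrow y\}=[*\leftarrow b']E'$, where $c^\alpha$ is obtained from $c$ by renaming the variables of $\mathrm{dom}(c)$ with distinct variables that do not occur in $E[z\leftarrow xy]E_v$; - $E[z\leftarrow xy]E_v\to_{m_2} E[z\leftarrow E_v(y_1')]E_v$ if $E_v(x)=\lambda x_1.[*\leftarrow y_1]$ and $y_1'$ is $y_1\{x_1\leftarrow y\}$. **Read-back.** The read-back of bites and crumbles into terms is $(xy)^{\downarrow}=xy$, $(\lambda x.[*\leftarrow y])^{\downarrow}=\lambda x.y$, $(\lambda x.c)^{\downarrow}=\lambda x.c^{\downarrow}$, $[*\leftarrow b]^{\downarrow}=b^{\downarrow}$, $(c[x\leftarrow b])^{\downarrow}=c^{\downarrow}\{x\leftarrow b^{\downarrow}\}$. For environment contexts, $[*\leftarrow\langle\cdot\rangle]^{\downarrow}=\langle\cdot\rangle$,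 and $(c[z\leftarrow\langle\cdot\rangle])^{\downarrow}=c^{\downarrow}\{z\leftarrow\langle\cdot\rangle\}$, in which every free occurrence of $z$ becomes a hole. **Lemma (Invariants of finest crumbling).** Let $t$ be a closed term, let $E_0=\underline t$ be its crumbling, and let $E$ be a crumble such that $E_0\to_{Cr}^* E$. Then: 1. *Freshness:* $E$ is well-named. 2. *Closure:* $\mathrm{fv}(E)=\emptyset$. 3. *Bodies:* every body occurring in $E$ is $B_0\sigma$ for some body $B_0$ occurring in the initial crumble $E_0$ and some capture-avoiding substitution $\sigma$ of variables for variables. 4. *Contextual decoding:* whenever $E=E_1[z\leftarrow xy]E_2$ (where $z$ may be $*$), the read-back of $E_1[z\leftarrow\langle\cdot\rangle]$ is a right v-context. -/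

import Mathlib

namespace FinestCrumbling

/-- Variables: a countably infinite set of names. The special name `*`, which can only be assigned
in the leftmost entry of an environment and cannot be referred to, is not a variable. -/
abbrev Var := ℕ

/-- A variable that does not belong to the finite set `S`. -/
def freshVar (S : Finset Var) : Var := S.sup id + 1

/-- `x` itself if it does not belong to `S`, and otherwise a variable outside `S`: the name taken by
a binder `x` in a substitution when the variables in `S` must not be captured. -/
def avoid (x : Var) (S : Finset Var) : Var := if x ∈ S then freshVar S else x

/-! ### Plotkin's call-by-value calculus -/

/-- Terms of the lambda-calculus. -/
inductive Term where
  | var (x : Var)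
  | lam (x : Var) (t : Term)
  | app (t u : Term)

namespace Term

/-- Values are variables and abstractions. -/
def IsValue : Term → Prop
  | var _ => True
  | lam _ _ => True
  | app _ _ => False

/-- Free variables. -/
def fv : Term → Finset Var
  | var x => {x}
  | lam x t => t.fv.erase x
  | app t u => t.fv ∪ u.fv

/-- All the variables of a term: free, bound or binding. -/
def vars : Term → Finset Var
  | var x => {x}
  | lam x t => insert x t.vars
  | app t u => t.vars ∪ u.vars

/-- Capture-avoiding simultaneous substitution. -/
def subst : Term → (Var → Term) → Term
  | var x, σ => σ x
  | lam x t, σ =>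
    let x' := avoid x ((t.fv.erase x).biUnion fun y => (σ y).fv)
    lam x' (t.subst (Function.update σ x (var x')))
  | app t u, σ => app (t.subst σ) (u.subst σ)

/-- `t.substVar x s` is `t{x ← s}`. -/
def substVar (t : Term) (x : Var) (s : Term) : Term := t.subst (Function.update var x s)

end Term

/-- Terms in which any number of holes `⟨·⟩` may occur. -/
inductive HoleTerm where
  | hole
  | var (x : Var)
  | lam (x : Var) (t : HoleTerm)
  | app (t u : HoleTerm)

/-- A term, seen as a term with no hole. -/
def HoleTerm.ofTerm : Term → HoleTerm
  | .var x => .var x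
  | .lam x t => .lam x (ofTerm t)
  | .app t u => .app (ofTerm t) (ofTerm u)

/-- `t.substHole x` is `t{x ← ⟨·⟩}`: every free occurrence of `x` is replaced by a hole. -/
def Term.substHole : Term → Var → HoleTerm
  | .var y, x => if y = x then .hole else .var y
  | .lam y t, x => if y = x then .ofTerm (.lam y t) else .lam y (t.substHole x)
  | .app t u, x => .app (t.substHole x) (u.substHole x)

/-- Right v-contexts: `R ::= ⟨·⟩ | t R | R v`, for `t` a term and `v` a value. -/
inductive IsRightVContext : HoleTerm → Prop
  | hole : IsRightVContext .hole
  | appRight (t : Term) {R : HoleTerm} (hR : IsRightVContext R) :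
      IsRightVContext (.app (.ofTerm t) R)
  | appLeft {R : HoleTerm} (hR : IsRightVContext R) (v : Term) (hv : v.IsValue) :
      IsRightVContext (.app R (.ofTerm v))

/-! ### Bites, crumbles and environments -/

mutual
/-- Bites: `x y`, `λ x. [* ← y]`, and `λ x. c` for a crumble `c`. -/
inductive Bite where
  | app (x y : Var)
  | lamVar (x y : Var)
  | lam (x : Var) (c : Crumble)

/-- Crumbles, that is environments whose leftmost entry (and no other) assigns to `*`:
`ret b` is `[* ← b]` and `snoc c z b` is `c [z ← b]`. -/
inductive Crumble where
  | ret (b : Bite)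
  | snoc (c : Crumble) (z : Var) (b : Bite)
end

/-- Environments `[z₁ ← b₁] ⋯ [zₙ ← bₙ]` with no assignment to `*`, listed from left to right. -/
abbrev Env := List (Var × Bite)

/-- `c ++ E`: the concatenation of a crumble and an environment. -/
def Crumble.append (c : Crumble) (E : Env) : Crumble := E.foldl (fun d p => d.snoc p.1 p.2) c

instance : HAppend Crumble Env Crumble := ⟨Crumble.append⟩

/-- Crumbled values are the abstractions. -/
def Bite.IsValue : Bite → Prop
  | .app _ _ => False
  | .lamVar _ _ => True
  | .lam _ _ => True

/-- v-environments: every entry assigns a value. -/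
def IsVEnv (E : Env) : Prop := ∀ p ∈ E, p.2.IsValue

mutual
/-- Free variables of a bite. -/
def Bite.fv : Bite → Finset Var
  | .app x y => {x, y}
  | .lamVar x y => Finset.erase {y} x
  | .lam x c => c.fv.erase x

/-- Free variables of a crumble: in `c [z ← b]` the variable `z` is bound in `c`. -/
def Crumble.fv : Crumble → Finset Var
  | .ret b => b.fv
  | .snoc c z b => c.fv.erase z ∪ b.fv
end

/-- Free variables of an environment: `fv ε = ∅` and `fv (E [z ← b]) = (fv E ∖ {z}) ∪ fv b`. -/
def Env.fv (E : Env) : Finset Var := E.foldl (fun S p => S.erase p.1 ∪ p.2.fv) ∅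

/-- The domain of a crumble, from left to right and without the leftmost name `*`. -/
def Crumble.dom : Crumble → List Var
  | .ret _ => []
  | .snoc c z _ => c.dom ++ [z]

mutual
/-- Bound variables of a bite: the variables bound by an abstraction, at any depth. -/
def Bite.bv : Bite → Finset Var
  | .app _ _ => ∅
  | .lamVar x _ => {x}
  | .lam x c => insert x c.bv

/-- Bound variables of a crumble: the variables bound by an abstraction, at any depth. -/
def Crumble.bv : Crumble → Finset Var
  | .ret b => b.bv
  | .snoc c _ b => c.bv ∪ b.bv
end

mutual
/-- All the variables of a bite: free, bound, binding, or in the domain of a body. -/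
def Bite.vars : Bite → Finset Var
  | .app x y => {x, y}
  | .lamVar x y => {x, y}
  | .lam x c => insert x c.vars

/-- All the variables of a crumble: free, bound, binding, or in a domain, at any depth. -/
def Crumble.vars : Crumble → Finset Var
  | .ret b => b.vars
  | .snoc c z b => insert z (c.vars ∪ b.vars)
end

mutual
/-- The variables assigned by explicit substitutions in a bite, at any depth, with repetitions. -/
def Bite.esVars : Bite → List Var
  | .app _ _ => []
  | .lamVar _ _ => []
  | .lam _ c => c.esVars

/-- The variables assigned by explicit substitutions in a crumble, at any depth, with
repetitions. -/
def Crumble.esVars : Crumble → List Var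
  | .ret b => b.esVars
  | .snoc c z b => c.esVars ++ z :: b.esVars
end

mutual
/-- Capture-avoiding simultaneous substitution of variables for the free variables of a bite. -/
def Bite.subst : Bite → (Var → Var) → Bite
  | .app x y, σ => .app (σ x) (σ y)
  | .lamVar x y, σ =>
    let x' := avoid x ((Finset.erase {y} x).image σ)
    .lamVar x' (Function.update σ x x' y)
  | .lam x c, σ =>
    let x' := avoid x ((c.fv.erase x).image σ)
    .lam x' (c.subst (Function.update σ x x'))

/-- Capture-avoiding simultaneous substitution of variables for the free variables of a crumble. -/
def Crumble.subst : Crumble → (Var → Var) → Crumble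
  | .ret b, σ => .ret (b.subst σ)
  | .snoc c z b, σ =>
    let z' := avoid z ((c.fv.erase z).image σ)
    .snoc (c.subst (Function.update σ z z')) z' (b.subst σ)
end

/-- `c.substVar x y` is `c{x ← y}`. -/
def Crumble.substVar (c : Crumble) (x y : Var) : Crumble := c.subst (Function.update id x y)

/-- The crumble `c` with each variable `z` of its domain renamed to `ρ z`, in the entry that assigns
it and in the entries on the left of that one, which form its scope. The argument `σ` is the renaming
to be applied to the free variables of `c`, hence `id` at the outset. -/
def Crumble.renameDom (ρ : Var → Var) : Crumble → (Var → Var) → Crumble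
  | .ret b, σ => .ret (b.subst σ)
  | .snoc c z b, σ => .snoc (c.renameDom ρ (Function.update σ z (ρ z))) (ρ z) (b.subst σ)

/-- Well-named crumbles. (The name `*` is distinct from all variables and never occurs free.) -/
def WellNamed (c : Crumble) : Prop :=
  c.dom.Nodup ∧
  (∀ x ∈ c.dom, x ∉ c.bv) ∧
  ∀ (c₁ : Crumble) (z : Var) (b : Bite) (E₂ : Env),
    c = c₁.snoc z b ++ E₂ → z ∉ b.fv ∪ Env.fv E₂

/-- Bodies of abstractions: `[* ← y]` or a crumble. -/
inductive Body where
  | retVar (y : Var)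
  | crumble (c : Crumble)

/-- Capture-avoiding simultaneous substitution of variables for the free variables of a body. -/
def Body.subst : Body → (Var → Var) → Body
  | .retVar y, σ => .retVar (σ y)
  | .crumble c, σ => .crumble (c.subst σ)

mutual
/-- The bodies of the abstractions that occur in a bite, at any depth. -/
def Bite.bodies : Bite → Set Body
  | .app _ _ => ∅
  | .lamVar _ y => {Body.retVar y}
  | .lam _ c => insert (Body.crumble c) c.bodies

/-- The bodies of the abstractions that occur in a crumble, at any depth. -/
def Crumble.bodies : Crumble → Set Body
  | .ret b => b.bodies
  | .snoc c _ b => c.bodies ∪ b.bodies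
end

/-! ### Environment contexts and read-back -/

/-- Environment contexts that begin like a crumble: `[* ← ⟨·⟩]` and `c [z ← ⟨·⟩]`. -/
inductive EnvContext where
  | ret
  | snoc (c : Crumble) (z : Var)

/-- Plugging a bite in an environment context. -/
def EnvContext.plug : EnvContext → Bite → Crumble
  | .ret, b => .ret b
  | .snoc c z, b => .snoc c z b

mutual
/-- The read-back of a bite. -/
def Bite.readBack : Bite → Term
  | .app x y => .app (.var x) (.var y)
  | .lamVar x y => .lam x (.var y)
  | .lam x c => .lam x c.readBack

/-- The read-back of a crumble. -/
def Crumble.readBack : Crumble → Term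
  | .ret b => b.readBack
  | .snoc c x b => c.readBack.substVar x b.readBack
end

/-- The read-back of an environment context. -/
def EnvContext.readBack : EnvContext → HoleTerm
  | .ret => .hole
  | .snoc c z => c.readBack.substHole z

/-! ### The crumbling translation -/

/-- `CrumblesTo t c`: the equations of the translation, for some choice of the introduced variables.
No equation applies to a variable, so `u` and `u'` are not variables where they are translated. -/
inductive CrumblesTo : Term → Crumble → Prop
  | lamVar (x y : Var) : CrumblesTo (.lam x (.var y)) (.ret (.lamVar x y))
  | lam (x : Var) {t : Term} {c : Crumble} (h : CrumblesTo t c) :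
      CrumblesTo (.lam x t) (.ret (.lam x c))
  | appVarVar (x y : Var) : CrumblesTo (.app (.var x) (.var y)) (.ret (.app x y))
  | appLeft (x y : Var) {u : Term} {b : Bite} {E : Env}
      (h : CrumblesTo u (Crumble.ret b ++ E)) :
      CrumblesTo (.app u (.var y)) (Crumble.ret (.app x y) ++ (x, b) :: E)
  | appRight (x y : Var) {u' : Term} {b' : Bite} {E' : Env}
      (h' : CrumblesTo u' (Crumble.ret b' ++ E')) :
      CrumblesTo (.app (.var x) u') (Crumble.ret (.app x y) ++ (y, b') :: E')
  | app (x y : Var) {u u' : Term} {b b' : Bite} {E E' : Env}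
      (h : CrumblesTo u (Crumble.ret b ++ E)) (h' : CrumblesTo u' (Crumble.ret b' ++ E')) :
      CrumblesTo (.app u u') (Crumble.ret (.app x y) ++ (x, b) :: E ++ (y, b') :: E')

/-- `c` is the crumbling of `t`, for some choice of the fresh variables: the variables introduced by
the translation, at any depth, are pairwise distinct and do not occur in `t`. -/
def IsCrumbling (t : Term) (c : Crumble) : Prop :=
  CrumblesTo t c ∧ c.esVars.Nodup ∧ ∀ x ∈ c.esVars, x ∉ t.vars

theorem Crumble.esVars_append (c : Crumble) (E : Env) :
    (c ++ E).esVars = c.esVars ++ E.flatMap fun p => p.1 :: p.2.esVars := by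
  change (Crumble.append c E).esVars = _
  induction E generalizing c with
  | nil => simp [Crumble.append]
  | cons p E ih =>
    have h := ih (c.snoc p.1 p.2)
    simp only [Crumble.append, List.foldl_cons] at h ⊢
    rw [h]
    simp [Crumble.esVars]

theorem exists_crumblesTo (t : Term) (ht : ∀ x, t ≠ .var x) (n : ℕ) :
    ∃ (b : Bite) (E : Env) (m : ℕ), n ≤ m ∧ CrumblesTo t (Crumble.ret b ++ E) ∧
      (Crumble.ret b ++ E).esVars.Nodup ∧ ∀ x ∈ (Crumble.ret b ++ E).esVars, n ≤ x ∧ x < m := by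
  induction t generalizing n with
  | var x => exact absurd rfl (ht x)
  | lam x t ih =>
    cases t with
    | var y => exact ⟨_, [], n, le_rfl, .lamVar x y, by
        simp [Crumble.esVars_append, Crumble.esVars, Bite.esVars]⟩
    | lam _ _ | app _ _ =>
      obtain ⟨b, E, m, hm, hc, hn, hb⟩ := ih (by simp) n
      exact ⟨.lam x (Crumble.ret b ++ E), [], m, hm, .lam x hc, hn, hb⟩
  | app u u' ih ih' =>
    by_cases hu : ∃ x, u = .var x <;> by_cases hu' : ∃ y, u' = .var y
    · obtain ⟨x, rfl⟩ := hu
      obtain ⟨y, rfl⟩ := hu'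
      exact ⟨_, [], n, le_rfl, .appVarVar x y, by
        simp [Crumble.esVars_append, Crumble.esVars, Bite.esVars]⟩
    · obtain ⟨x, rfl⟩ := hu
      obtain ⟨b, E, m, hm, hc, hn, hb⟩ := ih' (fun y h => hu' ⟨y, h⟩) n
      refine ⟨_, _, m + 1, by omega, .appRight x m hc, ?_⟩
      simp only [Crumble.esVars_append, Crumble.esVars, Bite.esVars, List.flatMap_cons] at hn hb ⊢
      grind
    · obtain ⟨y, rfl⟩ := hu'
      obtain ⟨b, E, m, hm, hc, hn, hb⟩ := ih (fun y h => hu ⟨y, h⟩) n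
      refine ⟨_, _, m + 1, by omega, .appLeft m y hc, ?_⟩
      simp only [Crumble.esVars_append, Crumble.esVars, Bite.esVars, List.flatMap_cons] at hn hb ⊢
      grind
    · obtain ⟨b, E, m, hm, hc, hn, hb⟩ := ih (fun y h => hu ⟨y, h⟩) n
      obtain ⟨b', E', m', hm', hc', hn', hb'⟩ := ih' (fun y h => hu' ⟨y, h⟩) m
      have h := CrumblesTo.app m' (m' + 1) hc hc'
      have e : Crumble.ret (.app m' (m' + 1)) ++ (m', b) :: E ++ (m' + 1, b') :: E' =
          Crumble.ret (.app m' (m' + 1)) ++ ((m', b) :: E ++ (m' + 1, b') :: E') :=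
        (List.foldl_append ..).symm
      rw [e] at h
      refine ⟨_, _, m' + 2, by omega, h, ?_⟩
      simp only [Crumble.esVars_append, Crumble.esVars, Bite.esVars, List.flatMap_cons,
        List.flatMap_append] at hn hb hn' hb' ⊢
      grind

/-- Every term that is not a variable, in particular every closed term, has a crumbling. -/
theorem exists_isCrumbling (t : Term) (ht : ∀ x, t ≠ .var x) : ∃ c, IsCrumbling t c := by
  obtain ⟨b, E, m, -, hc, hn, hb⟩ := exists_crumblesTo t ht (freshVar t.vars)
  refine ⟨_, hc, hn, fun x hx hx' => ?_⟩
  have h1 := (hb x hx).1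
  have h2 : x ≤ t.vars.sup id := Finset.le_sup (f := id) hx'
  exact absurd (h1.trans h2) (Nat.not_succ_le_self _)

/-! ### Reduction -/

/-- The step `E [z ← x y] E_v → E [z ← b'] E' E_v`, where `E_v(x) = λ x₁. c` and `[* ← b'] E'` is
obtained from `c` by renaming its domain with distinct variables that occur nowhere in the
reduced crumble, followed by the substitution `{x₁ ← y}`. -/
inductive StepM1 : Crumble → Crumble → Prop
  | step (C : EnvContext) (x y : Var) (Ev : Env) (x₁ : Var) (c : Crumble) (ρ : Var → Var)
      (b' : Bite) (E' : Env) (hv : IsVEnv Ev)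
      (hx : Ev.lookup x = some (.lam x₁ c))
      (hinj : Set.InjOn ρ {z | z ∈ c.dom})
      (hfresh : ∀ z ∈ c.dom, ρ z ∉ (C.plug (.app x y) ++ Ev).vars)
      (hb : (c.renameDom ρ id).substVar x₁ y = Crumble.ret b' ++ E') :
      StepM1 (C.plug (.app x y) ++ Ev) (C.plug b' ++ E' ++ Ev)

/-- The step `E [z ← x y] E_v → E [z ← E_v(y₁')] E_v`, where `E_v(x) = λ x₁. [* ← y₁]` and `y₁'` is
`y₁{x₁ ← y}`. -/
inductive StepM2 : Crumble → Crumble → Prop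
  | step (C : EnvContext) (x y : Var) (Ev : Env) (x₁ y₁ : Var) (v : Bite) (hv : IsVEnv Ev)
      (hx : Ev.lookup x = some (.lamVar x₁ y₁))
      (hy : Ev.lookup (if y₁ = x₁ then y else y₁) = some v) :
      StepM2 (C.plug (.app x y) ++ Ev) (C.plug v ++ Ev)

/-- The reduction of the finest crumbled calculus. -/
def StepCr (c d : Crumble) : Prop := StepM1 c d ∨ StepM2 c d

end FinestCrumbling

open FinestCrumbling

/-!
The four properties are proved by strengthening them to an invariant of reduction, `Invariant`.

*Names.* Let `N` be the set of the names that are binding inside the bites of the initial crumble.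
They are kept apart from its domain. A step copies a body of an abstraction, gives its domain fresh
names, and substitutes a variable of the domain of the current crumble, because a closed crumble
only refers to its domain. So every renaming moves variables only onto names outside of `N`
(`Harmless`): capture-avoiding substitutions never have to rename a binder, they compose
(`Bite.subst_subst`), and `N` never changes. In particular every body remains an instance of an
initial body, and the crumble that replaces a redex is, as a whole, a renaming `d.ren H` of an
initial body `d` (`Crumble.renameDom_subst`, `Crumble.subst_renameDom`,
`Crumble.Scoped.renameDom_eq_ren`).

*Scopes.* Closure and well-naming follow from one compositional predicate, `Crumble.Scoped X`: every
entry refers only to `X` and to names assigned on its right, and no name is assigned twice or lies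
in `X`. It is stable under such renamings (`Crumble.Scoped.ren`).

*Decoding.* `RightVAt D s t` says that `t = R⟨s⟩` for a right v-context `R` that does not mention
the variables of `D`. Such contexts compose, and they commute with substitutions for variables of
`D`. The entries of a crumbling are listed in the depth-first order of the applications of the
term, from left to right. Where an entry is a hole, what is on the right of the path to the hole
is therefore still a variable, hence a value. This holds in every renaming of a crumbling that
keeps names distinct (`CrumblesTo.decodes_ren`), in particular in the copy of a body made by a
step. By composition it holds in the whole crumble (`EnvContext.Decodes.plug_append`), as the
entries on the right of the redex are values, of which decoding requires nothing.
-/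

namespace FinestCrumbling

/-! ### Variables of substituted bites and crumbles -/

theorem avoid_notMem (x : Var) (S : Finset Var) : avoid x S ∉ S := by
  unfold avoid
  split_ifs with h
  · intro hm
    exact absurd (Finset.le_sup (f := id) hm) (Nat.not_succ_le_self _)
  · exact h

theorem avoid_of_notMem {x : Var} {S : Finset Var} (h : x ∉ S) : avoid x S = x := if_neg h

theorem erase_image_update {S : Finset Var} {σ : Var → Var} {x x' : Var}
    (h : x' ∉ (S.erase x).image σ) :
    (S.image (Function.update σ x x')).erase x' = (S.erase x).image σ := by
  ext w
  simp only [Finset.mem_erase, Finset.mem_image, Function.update_apply] at h ⊢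
  grind

mutual
theorem Bite.fv_subst : ∀ (b : Bite) (σ : Var → Var), (b.subst σ).fv = b.fv.image σ
  | .app x y, σ => by simp [Bite.subst, Bite.fv, Finset.image_insert]
  | .lamVar x y, σ => by
    have h := erase_image_update (avoid_notMem x ((Finset.erase {y} x).image σ))
    rw [Finset.image_singleton] at h
    simpa only [Bite.subst, Bite.fv] using h
  | .lam x c, σ => by
    simp only [Bite.subst, Bite.fv, Crumble.fv_subst c, erase_image_update (avoid_notMem _ _)]

theorem Crumble.fv_subst : ∀ (c : Crumble) (σ : Var → Var), (c.subst σ).fv = c.fv.image σ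
  | .ret b, σ => by simp only [Crumble.subst, Crumble.fv, Bite.fv_subst b]
  | .snoc c z b, σ => by
    simp only [Crumble.subst, Crumble.fv, Crumble.fv_subst c, Bite.fv_subst b,
      erase_image_update (avoid_notMem _ _), Finset.image_union]
end

theorem image_erase_congr {S : Finset Var} {x : Var} {σ τ : Var → Var}
    (h : ∀ w ∈ S.erase x, σ w = τ w) : (S.erase x).image σ = (S.erase x).image τ :=
  Finset.image_congr fun w hw => h w hw

theorem update_congr {S : Finset Var} {x : Var} {σ τ : Var → Var}
    (h : ∀ w ∈ S.erase x, σ w = τ w) (x' : Var) :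
    ∀ w ∈ S, Function.update σ x x' w = Function.update τ x x' w := by
  intro w hw
  simp only [Function.update_apply]
  split_ifs with hx
  · rfl
  · exact h w (Finset.mem_erase.2 ⟨hx, hw⟩)

mutual
theorem Bite.subst_congr : ∀ (b : Bite) {σ τ : Var → Var}, (∀ w ∈ b.fv, σ w = τ w) →
    b.subst σ = b.subst τ
  | .app x y, σ, τ, h => by
    simp only [Bite.subst, h x (by simp [Bite.fv]), h y (by simp [Bite.fv])]
  | .lamVar x y, σ, τ, h => by
    simp only [Bite.fv] at h
    simp only [Bite.subst, image_erase_congr h]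
    rw [update_congr h _ y (by simp)]
  | .lam x c, σ, τ, h => by
    simp only [Bite.fv] at h
    simp only [Bite.subst, image_erase_congr h]
    rw [Crumble.subst_congr c (update_congr h _)]

theorem Crumble.subst_congr : ∀ (c : Crumble) {σ τ : Var → Var}, (∀ w ∈ c.fv, σ w = τ w) →
    c.subst σ = c.subst τ
  | .ret b, σ, τ, h => by simp only [Crumble.subst, Bite.subst_congr b h]
  | .snoc c z b, σ, τ, h => by
    simp only [Crumble.fv, Finset.mem_union] at h
    have h₁ : ∀ w ∈ c.fv.erase z, σ w = τ w := fun w hw => h w (.inl hw)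
    simp only [Crumble.subst, image_erase_congr h₁]
    rw [Crumble.subst_congr c (update_congr h₁ _), Bite.subst_congr b fun w hw => h w (.inr hw)]
end

theorem update_eq_of_fixed {σ : Var → Var} {x : Var} (h : σ x = x) : Function.update σ x x = σ :=
  Function.update_eq_self_iff.2 h.symm

theorem avoid_erase_image_id (x : Var) (S : Finset Var) : avoid x ((S.erase x).image id) = x :=
  avoid_of_notMem (by simp)

mutual
theorem Bite.subst_id : ∀ b : Bite, b.subst id = b
  | .app x y => rfl
  | .lamVar x y => by
    simp only [Bite.subst, avoid_erase_image_id, update_eq_of_fixed (id_eq x), id_eq]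
  | .lam x c => by
    simp only [Bite.subst, avoid_erase_image_id, update_eq_of_fixed (id_eq x),
      Crumble.subst_id c]

theorem Crumble.subst_id : ∀ c : Crumble, c.subst id = c
  | .ret b => by simp only [Crumble.subst, Bite.subst_id b]
  | .snoc c z b => by
    simp only [Crumble.subst, avoid_erase_image_id, update_eq_of_fixed (id_eq z),
      Crumble.subst_id c, Bite.subst_id b]
end

theorem Body.subst_id (B : Body) : B.subst id = B := by
  cases B with
  | retVar y => rfl
  | crumble c => simp only [Body.subst, Crumble.subst_id]

/-! ### Substitutions that cause no capture -/

/-- The names that are binding inside a bite: the variables of its abstractions, and the domains of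
their bodies, at any depth. -/
def Bite.binders (b : Bite) : Finset Var := b.bv ∪ b.esVars.toFinset

/-- The names that are binding in a crumble, at any depth, its own domain included. -/
def Crumble.binders (c : Crumble) : Finset Var := c.bv ∪ c.esVars.toFinset

theorem Bite.binders_lam (x : Var) (c : Crumble) :
    (Bite.lam x c).binders = insert x c.binders := by
  simp [Bite.binders, Crumble.binders, Bite.bv, Bite.esVars]

theorem Bite.binders_lamVar (x y : Var) : (Bite.lamVar x y).binders = {x} := by
  simp [Bite.binders, Bite.bv, Bite.esVars]

theorem Bite.binders_app (x y : Var) : (Bite.app x y).binders = ∅ := by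
  simp [Bite.binders, Bite.bv, Bite.esVars]

theorem Crumble.binders_ret (b : Bite) : (Crumble.ret b).binders = b.binders := rfl

theorem Crumble.binders_snoc (c : Crumble) (z : Var) (b : Bite) :
    (c.snoc z b).binders = insert z (c.binders ∪ b.binders) := by
  ext w
  simp only [Crumble.binders, Bite.binders, Crumble.bv, Crumble.esVars, Finset.mem_union,
    List.mem_toFinset, Finset.mem_insert, List.mem_append, List.mem_cons]
  tauto

/-- A renaming which moves no variable onto a name of `N`. Applied to an expression whose binders
all lie in `N`, it is never captured, so that no binder changes its name. -/
def Harmless (N : Finset Var) (σ : Var → Var) : Prop := ∀ w, σ w = w ∨ σ w ∉ N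

theorem Harmless.id (N : Finset Var) : Harmless N id := fun _ => .inl rfl

theorem Harmless.comp {N : Finset Var} {σ τ : Var → Var} (hτ : Harmless N τ) (hσ : Harmless N σ) :
    Harmless N (τ ∘ σ) := by
  intro w
  rcases hτ (σ w) with h | h
  · simpa [h] using hσ w
  · exact .inr h

theorem Harmless.update {N : Finset Var} {σ : Var → Var} (h : Harmless N σ) {x x' : Var}
    (hx : x' = x ∨ x' ∉ N) : Harmless N (Function.update σ x x') := by
  intro w
  rcases eq_or_ne w x with rfl | hw
  · simpa using hx
  · simpa [hw] using h w

theorem Harmless.avoid_eq {N : Finset Var} {σ : Var → Var} (h : Harmless N σ) {x : Var}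
    (hx : x ∈ N) (S : Finset Var) : avoid x ((S.erase x).image σ) = x := by
  refine avoid_of_notMem fun hm => ?_
  obtain ⟨w, hw, rfl⟩ := Finset.mem_image.1 hm
  rcases h w with h | h
  · exact (Finset.mem_erase.1 hw).1 h.symm
  · exact h hx

/-- Crossing a binder `x ∈ N`, harmless renamings compose, since `σ` maps no other variable to
`x`. -/
theorem Harmless.update_comp_update {N : Finset Var} {σ : Var → Var} (h : Harmless N σ) {x : Var}
    (hx : x ∈ N) (τ : Var → Var) (x' : Var) :
    Function.update τ x x' ∘ Function.update σ x x = Function.update (τ ∘ σ) x x' := by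
  funext w
  rcases eq_or_ne w x with rfl | hw
  · simp
  · have : σ w ≠ x := by
      rintro rfl
      rcases h w with h | h
      · exact hw h.symm
      · exact h hx
    simp [hw, this]

mutual
theorem Bite.subst_subst {N : Finset Var} : ∀ (b : Bite) {σ τ : Var → Var}, b.binders ⊆ N →
    Harmless N σ → Harmless N τ → (b.subst σ).subst τ = b.subst (τ ∘ σ)
  | .app x y, σ, τ, _, _, _ => rfl
  | .lamVar x y, σ, τ, hN, hσ, hτ => by
    have hx : x ∈ N := hN (by simp [Bite.binders_lamVar])
    simp only [Bite.subst, hσ.avoid_eq hx, hτ.avoid_eq hx, (hτ.comp hσ).avoid_eq hx,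
      ← hσ.update_comp_update hx, Function.comp_apply]
  | .lam x c, σ, τ, hN, hσ, hτ => by
    rw [Bite.binders_lam, Finset.insert_subset_iff] at hN
    simp only [Bite.subst, hσ.avoid_eq hN.1, hτ.avoid_eq hN.1, (hτ.comp hσ).avoid_eq hN.1,
      ← hσ.update_comp_update hN.1]
    rw [Crumble.subst_subst c hN.2 (hσ.update (.inl rfl)) (hτ.update (.inl rfl))]

theorem Crumble.subst_subst {N : Finset Var} : ∀ (c : Crumble) {σ τ : Var → Var}, c.binders ⊆ N →
    Harmless N σ → Harmless N τ → (c.subst σ).subst τ = c.subst (τ ∘ σ)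
  | .ret b, σ, τ, hN, hσ, hτ => by
    simp only [Crumble.subst, Bite.subst_subst b hN hσ hτ]
  | .snoc c z b, σ, τ, hN, hσ, hτ => by
    rw [Crumble.binders_snoc, Finset.insert_subset_iff, Finset.union_subset_iff] at hN
    simp only [Crumble.subst, hσ.avoid_eq hN.1, hτ.avoid_eq hN.1, (hτ.comp hσ).avoid_eq hN.1,
      ← hσ.update_comp_update hN.1, Bite.subst_subst b hN.2.2 hσ hτ]
    rw [Crumble.subst_subst c hN.2.1 (hσ.update (.inl rfl)) (hτ.update (.inl rfl))]
end

mutual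
theorem Bite.binders_subst {N : Finset Var} : ∀ (b : Bite) {σ : Var → Var}, b.binders ⊆ N →
    Harmless N σ → (b.subst σ).binders = b.binders
  | .app x y, σ, _, _ => by simp only [Bite.subst, Bite.binders_app]
  | .lamVar x y, σ, hN, hσ => by
    have hx : x ∈ N := hN (by simp [Bite.binders_lamVar])
    simp only [Bite.subst, hσ.avoid_eq hx, Bite.binders_lamVar]
  | .lam x c, σ, hN, hσ => by
    rw [Bite.binders_lam, Finset.insert_subset_iff] at hN
    simp only [Bite.subst, hσ.avoid_eq hN.1, Bite.binders_lam]
    rw [Crumble.binders_subst c hN.2 (hσ.update (.inl rfl))]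

theorem Crumble.binders_subst {N : Finset Var} : ∀ (c : Crumble) {σ : Var → Var}, c.binders ⊆ N →
    Harmless N σ → (c.subst σ).binders = c.binders
  | .ret b, σ, hN, hσ => by
    simpa only [Crumble.subst, Crumble.binders_ret] using Bite.binders_subst b hN hσ
  | .snoc c z b, σ, hN, hσ => by
    rw [Crumble.binders_snoc, Finset.insert_subset_iff, Finset.union_subset_iff] at hN
    simp only [Crumble.subst, hσ.avoid_eq hN.1, Crumble.binders_snoc,
      Bite.binders_subst b hN.2.2 hσ]
    rw [Crumble.binders_subst c hN.2.1 (hσ.update (.inl rfl))]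
end

mutual
/-- The bodies of a substituted bite are instances of its bodies: below an abstraction, the
substitution is updated at the variable of the abstraction. -/
theorem Bite.exists_of_mem_bodies_subst {N : Finset Var} {B : Body} : ∀ (b : Bite)
    {σ : Var → Var}, b.binders ⊆ N → Harmless N σ → B ∈ (b.subst σ).bodies →
    ∃ B₀ ∈ b.bodies, ∃ τ, Harmless N τ ∧ B = B₀.subst τ
  | .app x y, σ, _, _, hB => by simp [Bite.subst, Bite.bodies] at hB
  | .lamVar x y, σ, hN, hσ, hB => by
    have hx : x ∈ N := hN (by simp [Bite.binders_lamVar])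
    simp only [Bite.subst, Bite.bodies, hσ.avoid_eq hx, Set.mem_singleton_iff] at hB
    exact ⟨.retVar y, by simp [Bite.bodies], _, hσ.update (.inl rfl), hB⟩
  | .lam x c, σ, hN, hσ, hB => by
    rw [Bite.binders_lam, Finset.insert_subset_iff] at hN
    simp only [Bite.subst, Bite.bodies, hσ.avoid_eq hN.1, Set.mem_insert_iff] at hB
    have hσ' : Harmless N (Function.update σ x x) := hσ.update (.inl rfl)
    rcases hB with hB | hB
    · exact ⟨.crumble c, by simp [Bite.bodies], _, hσ', hB⟩
    · obtain ⟨B₀, hB₀, h⟩ := Crumble.exists_of_mem_bodies_subst c hN.2 hσ' hB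
      exact ⟨B₀, by simp [Bite.bodies, hB₀], h⟩

theorem Crumble.exists_of_mem_bodies_subst {N : Finset Var} {B : Body} : ∀ (c : Crumble)
    {σ : Var → Var}, c.binders ⊆ N → Harmless N σ → B ∈ (c.subst σ).bodies →
    ∃ B₀ ∈ c.bodies, ∃ τ, Harmless N τ ∧ B = B₀.subst τ
  | .ret b, σ, hN, hσ, hB => Bite.exists_of_mem_bodies_subst b hN hσ hB
  | .snoc c z b, σ, hN, hσ, hB => by
    rw [Crumble.binders_snoc, Finset.insert_subset_iff, Finset.union_subset_iff] at hN
    simp only [Crumble.subst, Crumble.bodies, hσ.avoid_eq hN.1, Set.mem_union] at hB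
    rcases hB with hB | hB
    · obtain ⟨B₀, hB₀, h⟩ :=
        Crumble.exists_of_mem_bodies_subst c hN.2.1 (hσ.update (.inl rfl)) hB
      exact ⟨B₀, by simp [Crumble.bodies, hB₀], h⟩
    · obtain ⟨B₀, hB₀, h⟩ := Bite.exists_of_mem_bodies_subst b hN.2.2 hσ hB
      exact ⟨B₀, by simp [Crumble.bodies, hB₀], h⟩
end

/-! ### Entries of crumbles -/

/-- The bites of the entries of a crumble, from left to right. -/
def Crumble.bites : Crumble → List Bite
  | .ret b => [b]
  | .snoc c _ b => c.bites ++ [b]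

theorem Crumble.append_nil (c : Crumble) : c ++ ([] : Env) = c := rfl

theorem Crumble.append_cons (c : Crumble) (p : Var × Bite) (E : Env) :
    c ++ (p :: E : Env) = c.snoc p.1 p.2 ++ E := rfl

theorem Crumble.append_append (c : Crumble) (E E' : Env) : c ++ (E ++ E') = c ++ E ++ E' :=
  List.foldl_append ..

theorem Crumble.bites_append (c : Crumble) (E : Env) :
    (c ++ E).bites = c.bites ++ E.map Prod.snd := by
  induction E generalizing c with
  | nil => simp [Crumble.append_nil]
  | cons p E ih => simp [Crumble.append_cons, ih, Crumble.bites]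

theorem Crumble.dom_append (c : Crumble) (E : Env) : (c ++ E).dom = c.dom ++ E.map Prod.fst := by
  induction E generalizing c with
  | nil => simp [Crumble.append_nil]
  | cons p E ih => simp [Crumble.append_cons, ih, Crumble.dom]

theorem Crumble.mem_bodies {c : Crumble} {B : Body} :
    B ∈ c.bodies ↔ ∃ b ∈ c.bites, B ∈ b.bodies := by
  induction c using Crumble.rec (motive_1 := fun _ => True) with
  | ret b => simp [Crumble.bodies, Crumble.bites]
  | snoc c z b ih =>
    simp only [Crumble.bodies, Crumble.bites, Set.mem_union, ih, List.mem_append,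
      List.mem_singleton]
    grind
  | _ => trivial

theorem Crumble.mem_bv {c : Crumble} {x : Var} : x ∈ c.bv ↔ ∃ b ∈ c.bites, x ∈ b.bv := by
  induction c using Crumble.rec (motive_1 := fun _ => True) with
  | ret b => simp [Crumble.bv, Crumble.bites]
  | snoc c z b ih =>
    simp only [Crumble.bv, Crumble.bites, Finset.mem_union, ih, List.mem_append,
      List.mem_singleton]
    grind
  | _ => trivial

theorem Crumble.mem_esVars {c : Crumble} {x : Var} :
    x ∈ c.esVars ↔ x ∈ c.dom ∨ ∃ b ∈ c.bites, x ∈ b.esVars := by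
  induction c using Crumble.rec (motive_1 := fun _ => True) with
  | ret b => simp [Crumble.esVars, Crumble.bites, Crumble.dom]
  | snoc c z b ih =>
    simp only [Crumble.esVars, Crumble.bites, Crumble.dom, ih, List.mem_append,
      List.mem_cons]
    grind
  | _ => trivial

theorem Crumble.mem_binders {c : Crumble} {x : Var} :
    x ∈ c.binders ↔ x ∈ c.dom ∨ ∃ b ∈ c.bites, x ∈ b.binders := by
  simp only [Crumble.binders, Bite.binders, Finset.mem_union, List.mem_toFinset, Crumble.mem_bv,
    Crumble.mem_esVars]
  grind

theorem Crumble.mem_vars_of_mem_dom {c : Crumble} {x : Var} (h : x ∈ c.dom) : x ∈ c.vars := by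
  induction c using Crumble.rec (motive_1 := fun _ => True) with
  | ret b => simp [Crumble.dom] at h
  | snoc c z b ih =>
    simp only [Crumble.dom, Crumble.vars, List.mem_append, List.mem_singleton, Finset.mem_insert,
      Finset.mem_union] at h ⊢
    tauto
  | _ => trivial

theorem Crumble.vars_subset_of_mem_bites {c : Crumble} {b : Bite} (h : b ∈ c.bites) :
    b.vars ⊆ c.vars := by
  induction c using Crumble.rec (motive_1 := fun _ => True) with
  | ret b => simp_all [Crumble.bites, Crumble.vars]
  | snoc c z b ih =>
    simp only [Crumble.bites, List.mem_append, List.mem_singleton] at h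
    intro w hw
    simp only [Crumble.vars, Finset.mem_insert, Finset.mem_union]
    rcases h with h | rfl
    · exact .inr (.inl (ih h hw))
    · exact .inr (.inr hw)
  | _ => trivial

mutual
theorem Bite.binders_subset_vars : ∀ b : Bite, b.binders ⊆ b.vars
  | .app x y => by simp [Bite.binders_app]
  | .lamVar x y => by simp [Bite.binders_lamVar, Bite.vars]
  | .lam x c => by
    rw [Bite.binders_lam, Bite.vars]
    exact Finset.insert_subset_insert _ (Crumble.binders_subset_vars c)

theorem Crumble.binders_subset_vars : ∀ c : Crumble, c.binders ⊆ c.vars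
  | .ret b => Bite.binders_subset_vars b
  | .snoc c z b => by
    rw [Crumble.binders_snoc, Crumble.vars]
    exact Finset.insert_subset_insert _
      (Finset.union_subset_union (Crumble.binders_subset_vars c) (Bite.binders_subset_vars b))
end

mutual
theorem Bite.bodies_trans {c : Crumble} {B : Body} : ∀ b : Bite, Body.crumble c ∈ b.bodies →
    B ∈ c.bodies → B ∈ b.bodies
  | .app x y, h, _ => by simp [Bite.bodies] at h
  | .lamVar x y, h, _ => by simp [Bite.bodies] at h
  | .lam x d, h, hB => by
    simp only [Bite.bodies, Set.mem_insert_iff, Body.crumble.injEq] at h ⊢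
    rcases h with rfl | h
    · exact .inr hB
    · exact .inr (Crumble.bodies_trans d h hB)

theorem Crumble.bodies_trans {c : Crumble} {B : Body} : ∀ d : Crumble,
    Body.crumble c ∈ d.bodies → B ∈ c.bodies → B ∈ d.bodies
  | .ret b, h, hB => Bite.bodies_trans b h hB
  | .snoc d z b, h, hB => by
    simp only [Crumble.bodies, Set.mem_union] at h ⊢
    exact h.imp (fun h => Crumble.bodies_trans d h hB) (fun h => Bite.bodies_trans b h hB)
end

/-! ### Scoping -/

/-- The crumble `c` is well-scoped over `X`: the names of its domain are pairwise distinct and do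
not lie in `X`, and the free variables of each entry are in `X` or assigned on its right. -/
def Crumble.Scoped : Finset Var → Crumble → Prop
  | X, .ret b => b.fv ⊆ X
  | X, .snoc c z b => z ∉ X ∧ b.fv ⊆ X ∧ c.Scoped (insert z X)

/-- The counterpart of `Crumble.Scoped` for environments. -/
def Env.Scoped (X : Finset Var) : Env → Prop
  | [] => True
  | (z, b) :: E => z ∉ X ∪ (E.map Prod.fst).toFinset ∧ b.fv ⊆ X ∪ (E.map Prod.fst).toFinset ∧
      Env.Scoped X E

theorem Crumble.scoped_append {X : Finset Var} {c : Crumble} {E : Env} :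
    (c ++ E).Scoped X ↔ Env.Scoped X E ∧ c.Scoped (X ∪ (E.map Prod.fst).toFinset) := by
  induction E generalizing c with
  | nil => simp [Crumble.append_nil, Env.Scoped]
  | cons p E ih =>
    rw [Crumble.append_cons, ih]
    simp only [Crumble.Scoped, Env.Scoped, List.map_cons, List.toFinset_cons,
      Finset.union_insert]
    tauto

theorem Crumble.Scoped.notMem_dom {X : Finset Var} {c : Crumble} (h : c.Scoped X) {x : Var}
    (hx : x ∈ X) : x ∉ c.dom := by
  induction c using Crumble.rec (motive_1 := fun _ => True) generalizing X with
  | ret b => simp [Crumble.dom]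
  | snoc c z b ih =>
    simp only [Crumble.dom, List.mem_append, List.mem_singleton, not_or]
    exact ⟨ih h.2.2 (Finset.mem_insert_of_mem hx), fun e => h.1 (e ▸ hx)⟩
  | _ => trivial

theorem Crumble.Scoped.dom_nodup {X : Finset Var} {c : Crumble} (h : c.Scoped X) :
    c.dom.Nodup := by
  induction c using Crumble.rec (motive_1 := fun _ => True) generalizing X with
  | ret b => simp [Crumble.dom]
  | snoc c z b ih =>
    have := h.2.2.notMem_dom (Finset.mem_insert_self z X)
    simp only [Crumble.dom, List.nodup_append, List.mem_singleton, List.nodup_singleton]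
    exact ⟨ih h.2.2, trivial, by rintro a ha _ rfl rfl; exact this ha⟩
  | _ => trivial

theorem Crumble.Scoped.fv_subset {X : Finset Var} {c : Crumble} (h : c.Scoped X) : c.fv ⊆ X := by
  induction c using Crumble.rec (motive_1 := fun _ => True) generalizing X with
  | ret b => exact h
  | snoc c z b ih =>
    exact Finset.union_subset (Finset.subset_insert_iff.1 (ih h.2.2)) h.2.1
  | _ => trivial

theorem Crumble.Scoped.mono {X Y : Finset Var} {c : Crumble} (h : c.Scoped X) (hXY : X ⊆ Y)
    (hY : ∀ y ∈ Y, y ∉ c.dom) : c.Scoped Y := by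
  induction c using Crumble.rec (motive_1 := fun _ => True) generalizing X Y with
  | ret b => exact Finset.Subset.trans h hXY
  | snoc c z b ih =>
    simp only [Crumble.dom, List.mem_append, List.mem_singleton, not_or] at hY
    refine ⟨fun hz => (hY z hz).2 rfl, h.2.1.trans hXY,
      ih h.2.2 (Finset.insert_subset_insert _ hXY) fun y hy => ?_⟩
    rcases Finset.mem_insert.1 hy with rfl | hy
    · exact h.2.2.notMem_dom (Finset.mem_insert_self _ _)
    · exact (hY y hy).1
  | _ => trivial

/-- Scoping over any set implies scoping over the free variables, the least possible set. -/
theorem Crumble.Scoped.restrict {X : Finset Var} {c : Crumble} (h : c.Scoped X) :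
    c.Scoped c.fv := by
  induction c using Crumble.rec (motive_1 := fun _ => True) generalizing X with
  | ret b => exact Finset.Subset.refl _
  | snoc c z b ih =>
    have hs : (c.snoc z b).fv ⊆ X := h.fv_subset
    refine ⟨fun hz => h.1 (hs hz), Finset.subset_union_right,
      (ih h.2.2).mono (fun w hw => ?_) fun w hw =>
        h.2.2.notMem_dom (Finset.insert_subset_insert z hs hw)⟩
    simp only [Crumble.fv, Finset.mem_insert, Finset.mem_union, Finset.mem_erase]
    tauto
  | _ => trivial

theorem Env.Scoped.fv_subset {X : Finset Var} {E : Env} (h : Env.Scoped X E) {p : Var × Bite}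
    (hp : p ∈ E) : p.2.fv ⊆ X ∪ (E.map Prod.fst).toFinset := by
  induction E with
  | nil => simp at hp
  | cons q E ih =>
    have hs : X ∪ (E.map Prod.fst).toFinset ⊆ X ∪ ((q :: E).map Prod.fst).toFinset := by
      simp [Finset.union_insert]
    rcases List.mem_cons.1 hp with rfl | hp
    · exact h.2.1.trans hs
    · exact (ih h.2.2 hp).trans hs

theorem Env.fv_subset_fv_append (c : Crumble) (E : Env) : Env.fv E ⊆ (c ++ E).fv := by
  suffices H : ∀ (E : Env) (c : Crumble) (S : Finset Var), S ⊆ c.fv →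
      E.foldl (fun S p => S.erase p.1 ∪ p.2.fv) S ⊆ (c ++ E).fv from
    H E c ∅ (Finset.empty_subset _)
  intro E
  induction E with
  | nil => exact fun c S h => h
  | cons p E ih =>
    intro c S h
    exact ih (c.snoc p.1 p.2) _ (Finset.union_subset_union_left (Finset.erase_subset_erase _ h))

theorem Crumble.Scoped.wellNamed {c : Crumble} (h : c.Scoped ∅) (hbv : ∀ x ∈ c.dom, x ∉ c.bv) :
    WellNamed c := by
  refine ⟨h.dom_nodup, hbv, ?_⟩
  rintro c₁ z b E₂ rfl hz
  have hE := (Env.fv_subset_fv_append (c₁.snoc z b) E₂).trans h.fv_subset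
  obtain ⟨-, hz', hb, -⟩ := Crumble.scoped_append.1 h
  rcases Finset.mem_union.1 hz with hz | hz
  · exact hz' (hb hz)
  · exact absurd (hE hz) (Finset.notMem_empty z)

/-! ### Renaming of well-scoped crumbles -/

/-- The renaming of a crumble along one and the same function, on its domain and in all its
entries. -/
def Crumble.ren (F : Var → Var) : Crumble → Crumble
  | .ret b => .ret (b.subst F)
  | .snoc c z b => .snoc (c.ren F) (F z) (b.subst F)

/-- The counterpart of `Crumble.ren` for environments. -/
def Env.ren (F : Var → Var) (E : Env) : Env := E.map fun p => (F p.1, p.2.subst F)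

theorem Crumble.ren_append (F : Var → Var) (c : Crumble) (E : Env) :
    (c ++ E).ren F = c.ren F ++ Env.ren F E := by
  induction E generalizing c with
  | nil => rfl
  | cons p E ih => exact ih (c.snoc p.1 p.2)

theorem Crumble.ren_id (c : Crumble) : c.ren id = c := by
  induction c using Crumble.rec (motive_1 := fun _ => True) with
  | ret b => simp only [Crumble.ren, Bite.subst_id]
  | snoc c z b ih => simp only [Crumble.ren, ih, Bite.subst_id, id_eq]
  | _ => trivial

theorem Crumble.dom_ren (F : Var → Var) (c : Crumble) : (c.ren F).dom = c.dom.map F := by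
  induction c using Crumble.rec (motive_1 := fun _ => True) with
  | ret b => rfl
  | snoc c z b ih => simp [Crumble.ren, Crumble.dom, ih]
  | _ => trivial

theorem Crumble.bites_ren (F : Var → Var) (c : Crumble) :
    (c.ren F).bites = c.bites.map (Bite.subst · F) := by
  induction c using Crumble.rec (motive_1 := fun _ => True) with
  | ret b => rfl
  | snoc c z b ih => simp [Crumble.ren, Crumble.bites, ih]
  | _ => trivial

theorem Crumble.fv_ren_subset (F : Var → Var) (c : Crumble) : (c.ren F).fv ⊆ c.fv.image F := by
  induction c using Crumble.rec (motive_1 := fun _ => True) with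
  | ret b => exact (Bite.fv_subst b F).subset
  | snoc c z b ih =>
    simp only [Crumble.ren, Crumble.fv, Bite.fv_subst, Finset.image_union]
    refine Finset.union_subset_union_left fun w hw => ?_
    obtain ⟨hwz, hw⟩ := Finset.mem_erase.1 hw
    obtain ⟨v, hv, rfl⟩ := Finset.mem_image.1 (ih hw)
    exact Finset.mem_image_of_mem F (Finset.mem_erase.2 ⟨fun e => hwz (e ▸ rfl), hv⟩)
  | _ => trivial

theorem Crumble.Scoped.ren {X Y : Finset Var} {c : Crumble} (h : c.Scoped X) {F : Var → Var}
    (hX : ∀ x ∈ X, F x ∈ Y) (hF : Set.InjOn F {z | z ∈ c.dom}) (hY : ∀ z ∈ c.dom, F z ∉ Y) :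
    (c.ren F).Scoped Y := by
  have hfv : ∀ {b : Bite} {X Y : Finset Var}, (∀ x ∈ X, F x ∈ Y) → b.fv ⊆ X →
      (b.subst F).fv ⊆ Y := by
    intro b X Y hX hb
    rw [Bite.fv_subst]
    exact Finset.image_subset_iff.2 fun x hx => hX x (hb hx)
  induction c using Crumble.rec (motive_1 := fun _ => True) generalizing X Y with
  | ret b => exact hfv hX h
  | snoc c z b ih =>
    have hz : z ∈ (c.snoc z b).dom := by simp [Crumble.dom]
    have hc : ∀ w ∈ c.dom, w ∈ (c.snoc z b).dom := fun w hw => by simp [Crumble.dom, hw]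
    refine ⟨hY z hz, hfv hX h.2.1, ih h.2.2 (fun x hx => ?_) (hF.mono hc) fun w hw hwY => ?_⟩
    · rcases Finset.mem_insert.1 hx with rfl | hx
      · exact Finset.mem_insert_self _ _
      · exact Finset.mem_insert_of_mem (hX x hx)
    · rcases Finset.mem_insert.1 hwY with e | hwY
      · have := hF (hc w hw) hz e
        subst this
        exact h.2.2.notMem_dom (Finset.mem_insert_self _ _) hw
      · exact hY w (hc w hw) hwY
  | _ => trivial

/-- In a well-scoped crumble no entry contains a variable of the domain outside of its scope, so
that `renameDom` may use the same renaming in all the entries. -/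
theorem Crumble.Scoped.renameDom_eq_ren {X : Finset Var} {c : Crumble} (h : c.Scoped X)
    (ρ σ : Var → Var) :
    c.renameDom ρ σ = c.ren fun w => if w ∈ c.dom then ρ w else σ w := by
  induction c using Crumble.rec (motive_1 := fun _ => True) generalizing X σ with
  | ret b => simp [Crumble.renameDom, Crumble.ren, Crumble.dom]
  | snoc c z b ih =>
    simp only [Crumble.renameDom, Crumble.ren]
    rw [ih h.2.2, Bite.subst_congr b (σ := σ)
      (τ := fun w => if w ∈ (c.snoc z b).dom then ρ w else σ w)
      fun w hw => (if_neg (h.notMem_dom (h.2.1 hw))).symm]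
    have e : (fun w => if w ∈ c.dom then ρ w else Function.update σ z (ρ z) w) =
        fun w => if w ∈ (c.snoc z b).dom then ρ w else σ w := by
      funext w
      simp only [Crumble.dom, List.mem_append, List.mem_singleton, Function.update_apply]
      grind
    rw [e]
    simp [Crumble.dom]
  | _ => trivial

/-- A substitution and the renaming of the domain that follows it are merged into one renaming of
the domain. -/
theorem Crumble.renameDom_subst {N : Finset Var} {c : Crumble} {ρ σ f : Var → Var}
    (hN : c.binders ⊆ N) (hσ : Harmless N σ) (hf : Harmless N f) (hρ : ∀ z ∈ c.dom, ρ z ∉ N) :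
    (c.subst σ).renameDom ρ f = c.renameDom ρ (f ∘ σ) := by
  induction c using Crumble.rec (motive_1 := fun _ => True) generalizing σ f with
  | ret b => simp only [Crumble.subst, Crumble.renameDom, Bite.subst_subst b hN hσ hf]
  | snoc c z b ih =>
    rw [Crumble.binders_snoc, Finset.insert_subset_iff, Finset.union_subset_iff] at hN
    simp only [Crumble.dom, List.mem_append, List.mem_singleton] at hρ
    simp only [Crumble.subst, Crumble.renameDom, hσ.avoid_eq hN.1,
      Bite.subst_subst b hN.2.2 hσ hf]
    rw [ih hN.2.1 (hσ.update (.inl rfl)) (hf.update (.inr (hρ z (.inr rfl))))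
      fun w hw => hρ w (.inl hw), hσ.update_comp_update hN.1]
  | _ => trivial

/-- A renaming of the domain and the substitution that follows it are merged into one renaming of
the domain, if the substitution does not interfere with the new names of the domain. -/
theorem Crumble.subst_renameDom {N : Finset Var} {c : Crumble} {ρ f τ : Var → Var}
    (hN : c.binders ⊆ N) (hf : Harmless N f) (hτ : Harmless N τ) (hρ : ∀ z ∈ c.dom, ρ z ∉ N)
    (hfix : ∀ z ∈ c.dom, ∀ w, τ w = ρ z ↔ w = ρ z) :
    (c.renameDom ρ f).subst τ = c.renameDom ρ (τ ∘ f) := by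
  induction c using Crumble.rec (motive_1 := fun _ => True) generalizing f with
  | ret b => simp only [Crumble.subst, Crumble.renameDom, Bite.subst_subst b hN hf hτ]
  | snoc c z b ih =>
    rw [Crumble.binders_snoc, Finset.insert_subset_iff, Finset.union_subset_iff] at hN
    simp only [Crumble.dom, List.mem_append, List.mem_singleton] at hρ hfix
    have hz := hfix z (.inr rfl)
    have hτz : τ (ρ z) = ρ z := (hz _).2 rfl
    have hav : ∀ S : Finset Var, avoid (ρ z) ((S.erase (ρ z)).image τ) = ρ z := fun S =>
      avoid_of_notMem fun hm => by
        obtain ⟨w, hw, e⟩ := Finset.mem_image.1 hm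
        exact (Finset.mem_erase.1 hw).1 ((hz w).1 e)
    simp only [Crumble.subst, Crumble.renameDom, hav, update_eq_of_fixed hτz,
      Bite.subst_subst b hN.2.2 hf hτ]
    rw [ih hN.2.1 (hf.update (.inr (hρ z (.inr rfl)))) (fun w hw => hρ w (.inl hw))
      fun w hw => hfix w (.inl hw), Function.comp_update, hτz]
  | _ => trivial

/-! ### Occurrences in right v-contexts -/

theorem Term.mem_fv_subst {w : Var} {t : Term} {σ : Var → Term} (h : w ∈ (t.subst σ).fv) :
    ∃ y ∈ t.fv, w ∈ (σ y).fv := by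
  induction t generalizing σ with
  | var x => exact ⟨x, by simp [Term.fv], h⟩
  | lam x t ih =>
    simp only [Term.subst, Term.fv] at h
    obtain ⟨hw, h⟩ := Finset.mem_erase.1 h
    obtain ⟨y, hy, hwy⟩ := ih h
    rcases eq_or_ne y x with rfl | hyx
    · simp only [Function.update_self, Term.fv, Finset.mem_singleton] at hwy
      exact absurd hwy hw
    · rw [Function.update_of_ne hyx] at hwy
      exact ⟨y, Finset.mem_erase.2 ⟨hyx, hy⟩, hwy⟩
  | app t u iht ihu =>
    simp only [Term.subst, Term.fv, Finset.mem_union] at h ⊢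
    rcases h with h | h
    · obtain ⟨y, hy, hw⟩ := iht h
      exact ⟨y, .inl hy, hw⟩
    · obtain ⟨y, hy, hw⟩ := ihu h
      exact ⟨y, .inr hy, hw⟩

theorem Term.mem_fv_substVar {w z : Var} {t s : Term} (h : w ∈ (t.substVar z s).fv) :
    w ∈ t.fv.erase z ∨ w ∈ s.fv := by
  obtain ⟨y, hy, hw⟩ := Term.mem_fv_subst h
  rcases eq_or_ne y z with rfl | hyz
  · exact .inr (by simpa using hw)
  · simp only [Function.update_of_ne hyz, Term.fv, Finset.mem_singleton] at hw
    exact .inl (Finset.mem_erase.2 ⟨hw ▸ hyz, hw ▸ hy⟩)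

theorem Term.fv_substVar_subset {z : Var} {t : Term} (hz : z ∉ t.fv) (s : Term) :
    (t.substVar z s).fv ⊆ t.fv := by
  intro w hw
  obtain ⟨y, hy, hw⟩ := Term.mem_fv_subst hw
  have hyz : y ≠ z := by
    rintro rfl
    exact hz hy
  rw [Function.update_of_ne hyz] at hw
  simp only [Term.fv, Finset.mem_singleton] at hw
  exact hw ▸ hy

theorem Term.IsValue.substVar {v : Term} (hv : v.IsValue) {z : Var} (hz : z ∉ v.fv) (s : Term) :
    (v.substVar z s).IsValue := by
  cases v with
  | var x =>
    have hx : x ≠ z := fun e => hz (by simp [Term.fv, e])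
    simp [Term.substVar, Term.subst, hx, Term.IsValue]
  | lam x t => trivial
  | app t u => exact hv.elim

theorem Term.substHole_of_notMem {z : Var} {t : Term} (hz : z ∉ t.fv) :
    t.substHole z = .ofTerm t := by
  induction t with
  | var x =>
    have hx : x ≠ z := fun e => hz (by simp [Term.fv, e])
    simp [Term.substHole, HoleTerm.ofTerm, hx]
  | lam x t ih =>
    simp only [Term.substHole, HoleTerm.ofTerm]
    split_ifs with hx
    · rfl
    · rw [ih fun h => hz (Finset.mem_erase.2 ⟨Ne.symm hx, h⟩)]
  | app t u iht ihu =>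
    simp only [Term.fv, Finset.mem_union, not_or] at hz
    simp only [Term.substHole, HoleTerm.ofTerm, iht hz.1, ihu hz.2]

/-- `RightVAt D s t`: the term `t` is `R⟨s⟩` for a right v-context `R` in which no variable of `D`
is free. In particular `RightVAt {z} (.var z) t` says that `t` has exactly one free occurrence of
`z`, and that replacing it by a hole gives a right v-context. -/
inductive RightVAt (D : Finset Var) (s : Term) : Term → Prop
  | here : RightVAt D s s
  | appRight {t u : Term} (ht : ∀ w ∈ D, w ∉ t.fv) (hu : RightVAt D s u) :
      RightVAt D s (.app t u)
  | appLeft {t v : Term} (ht : RightVAt D s t) (hv : v.IsValue) (hD : ∀ w ∈ D, w ∉ v.fv) :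
      RightVAt D s (.app t v)

theorem RightVAt.isRightVContext {z : Var} {t : Term} (h : RightVAt {z} (.var z) t) :
    IsRightVContext (t.substHole z) := by
  induction h with
  | here => simpa [Term.substHole] using IsRightVContext.hole
  | appRight ht _ ih =>
    rw [Term.substHole, Term.substHole_of_notMem (ht z (Finset.mem_singleton_self z))]
    exact .appRight _ ih
  | appLeft _ hv hD ih =>
    rw [Term.substHole, Term.substHole_of_notMem (hD z (Finset.mem_singleton_self z))]
    exact .appLeft ih _ hv

theorem RightVAt.trans {D D' : Finset Var} {r s t : Term} (h : RightVAt D s t)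
    (hr : RightVAt D' r s) (hD : D' ⊆ D) : RightVAt D' r t := by
  induction h with
  | here => exact hr
  | appRight ht _ ih => exact .appRight (fun w hw => ht w (hD hw)) ih
  | appLeft _ hv hD' ih => exact .appLeft ih hv fun w hw => hD' w (hD hw)

theorem RightVAt.substVar {D : Finset Var} {s t : Term} (h : RightVAt D s t) {z : Var}
    (hz : z ∈ D) (u : Term) : RightVAt D (s.substVar z u) (t.substVar z u) := by
  induction h with
  | here => exact .here
  | appRight ht _ ih =>
    exact .appRight (fun w hw h => ht w hw (Term.fv_substVar_subset (ht z hz) u h)) ih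
  | appLeft _ hv hD ih =>
    exact .appLeft ih (hv.substVar (hD z hz) u) fun w hw h =>
      hD w hw (Term.fv_substVar_subset (hD z hz) u h)

/-- Plugging `s` for `z`: a right v-context with a named hole becomes one around `s`. -/
theorem RightVAt.plug {D : Finset Var} {z : Var} {t : Term} (h : RightVAt {z} (.var z) t)
    (hD : ∀ w ∈ D, w ∉ t.fv) (s : Term) : RightVAt D s (t.substVar z s) := by
  induction h with
  | here => simpa [Term.substVar, Term.subst] using RightVAt.here
  | appRight ht _ ih =>
    simp only [Term.fv, Finset.mem_union, not_or] at hD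
    have hz := ht z (Finset.mem_singleton_self z)
    exact .appRight (fun w hw h => (hD w hw).1 (Term.fv_substVar_subset hz s h))
      (ih fun w hw => (hD w hw).2)
  | appLeft _ hv hD' ih =>
    simp only [Term.fv, Finset.mem_union, not_or] at hD
    have hz := hD' z (Finset.mem_singleton_self z)
    exact .appLeft (ih fun w hw => (hD w hw).1) (hv.substVar hz s)
      (fun w hw h => (hD w hw).2 (Term.fv_substVar_subset hz s h))

/-! ### Contextual decoding of crumbles -/

mutual
theorem Bite.fv_readBack_subset : ∀ b : Bite, b.readBack.fv ⊆ b.fv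
  | .app x y => (Finset.insert_eq x {y}).ge
  | .lamVar x y => by simp [Bite.readBack, Term.fv, Bite.fv]
  | .lam x c => Finset.erase_subset_erase x (Crumble.fv_readBack_subset c)

theorem Crumble.fv_readBack_subset : ∀ c : Crumble, c.readBack.fv ⊆ c.fv
  | .ret b => Bite.fv_readBack_subset b
  | .snoc c z b => fun _ hw => Finset.mem_union.2 <| (Term.mem_fv_substVar hw).imp
      (fun h => Finset.erase_subset_erase z (Crumble.fv_readBack_subset c) h)
      (fun h => Bite.fv_readBack_subset b h)
end

/-- The read-back of an environment, performed on a term. -/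
def Env.readBackOn (t : Term) (E : Env) : Term :=
  E.foldl (fun t p => t.substVar p.1 p.2.readBack) t

theorem Crumble.readBack_append (c : Crumble) (E : Env) :
    (c ++ E).readBack = Env.readBackOn c.readBack E := by
  induction E generalizing c with
  | nil => rfl
  | cons p E ih => exact ih (c.snoc p.1 p.2)

theorem Env.readBackOn_app (t u : Term) (E : Env) :
    Env.readBackOn (.app t u) E = .app (Env.readBackOn t E) (Env.readBackOn u E) := by
  induction E generalizing t u with
  | nil => rfl
  | cons p E ih => exact ih (t.substVar p.1 p.2.readBack) (u.substVar p.1 p.2.readBack)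

theorem Env.readBackOn_var {y : Var} {E : Env} (hy : y ∉ E.map Prod.fst) :
    Env.readBackOn (.var y) E = .var y := by
  induction E with
  | nil => rfl
  | cons p E ih =>
    simp only [List.map_cons, List.mem_cons, not_or] at hy
    have e : (Term.var y).substVar p.1 p.2.readBack = .var y := by
      simp [Term.substVar, Term.subst, hy.1]
    exact (congrArg (Env.readBackOn · E) e).trans (ih hy.2)

/-- Contextual decoding: the read-back of the environment context around each entry that is not a
value is a right v-context. -/
def Crumble.Decodes : Crumble → Prop
  | .ret _ => True
  | .snoc c z b => c.Decodes ∧ (¬ b.IsValue → RightVAt {z} (.var z) c.readBack)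

/-- The counterpart of `Crumble.Decodes` for an environment on the right of a crumble whose
read-back is `t`. -/
def Env.Decodes : Term → Env → Prop
  | _, [] => True
  | t, (z, b) :: E => (¬ b.IsValue → RightVAt {z} (.var z) t) ∧
      Env.Decodes (t.substVar z b.readBack) E

theorem Crumble.decodes_append {c : Crumble} {E : Env} :
    (c ++ E).Decodes ↔ c.Decodes ∧ Env.Decodes c.readBack E := by
  induction E generalizing c with
  | nil => simp [Crumble.append_nil, Env.Decodes]
  | cons p E ih =>
    rw [Crumble.append_cons, ih]
    simp only [Crumble.Decodes, Env.Decodes, Crumble.readBack]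
    tauto

theorem Crumble.decodes_ret_append {b : Bite} {E : Env} :
    (Crumble.ret b ++ E).Decodes ↔ Env.Decodes b.readBack E := by
  simp [Crumble.decodes_append, Crumble.Decodes, Crumble.readBack]

theorem IsVEnv.decodes {E : Env} (hE : IsVEnv E) (t : Term) : Env.Decodes t E := by
  induction E generalizing t with
  | nil => trivial
  | cons p E ih =>
    exact ⟨fun h => absurd (hE p List.mem_cons_self) h,
      ih (fun q hq => hE q (List.mem_cons_of_mem p hq)) _⟩

/-- Right v-contexts compose, so that an environment which decodes on `s` decodes on `R⟨s⟩`. -/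
theorem RightVAt.decodes {D : Finset Var} {s t : Term} {E : Env} (h : RightVAt D s t)
    (hs : Env.Decodes s E) (hE : ∀ z ∈ E.map Prod.fst, z ∈ D) : Env.Decodes t E := by
  induction E generalizing s t with
  | nil => trivial
  | cons p E ih =>
    simp only [List.map_cons, List.mem_cons, forall_eq_or_imp] at hE
    exact ⟨fun hp => h.trans (hs.1 hp) (by simpa using hE.1),
      ih (h.substVar hE.1 _) hs.2 hE.2⟩

theorem Crumble.Decodes.isRightVContext {C : EnvContext} {x y : Var} {E : Env}
    (h : (C.plug (.app x y) ++ E).Decodes) : IsRightVContext C.readBack := by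
  cases C with
  | ret => exact .hole
  | snoc c z => exact ((Crumble.decodes_append.1 h).1.2 (fun h => h)).isRightVContext

/-! ### The crumbling translation -/

theorem Term.fv_subset_vars (t : Term) : t.fv ⊆ t.vars := by
  induction t with
  | var x => exact Finset.Subset.refl _
  | lam x t ih =>
    exact (Finset.erase_subset x t.fv).trans (ih.trans (Finset.subset_insert x t.vars))
  | app t u iht ihu => exact Finset.union_subset_union iht ihu

theorem Crumble.dom_sublist_esVars (c : Crumble) : c.dom.Sublist c.esVars := by
  induction c using Crumble.rec (motive_1 := fun _ => True) with
  | ret b => simp [Crumble.dom]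
  | snoc c z b ih => exact ih.append (List.Sublist.cons_cons z (List.nil_sublist _))
  | _ => trivial

theorem Crumble.bodies_append {c : Crumble} {E : Env} {B : Body} :
    B ∈ (c ++ E).bodies ↔ B ∈ c.bodies ∨ ∃ p ∈ E, B ∈ p.2.bodies := by
  simp only [Crumble.mem_bodies, Crumble.bites_append, List.mem_append, List.mem_map]
  grind

theorem Crumble.bv_append {c : Crumble} {E : Env} {x : Var} :
    x ∈ (c ++ E).bv ↔ x ∈ c.bv ∨ ∃ p ∈ E, x ∈ p.2.bv := by
  simp only [Crumble.mem_bv, Crumble.bites_append, List.mem_append, List.mem_map]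
  grind

theorem Crumble.fv_append_subset {c d : Crumble} {S : Finset Var} (E : Env)
    (h : c.fv ⊆ d.fv ∪ S) : (c ++ E).fv ⊆ (d ++ E).fv ∪ S := by
  induction E generalizing c d with
  | nil => exact h
  | cons p E ih =>
    refine ih (c := c.snoc p.1 p.2) (d := d.snoc p.1 p.2) fun w hw => ?_
    simp only [Crumble.fv, Finset.mem_union, Finset.mem_erase] at hw ⊢
    rcases hw with ⟨hw, hwc⟩ | hw
    · rcases Finset.mem_union.1 (h hwc) with hd | hS
      · exact .inl (.inl ⟨hw, hd⟩)
      · exact .inr hS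
    · exact .inl (.inr hw)

theorem Crumble.fv_snoc_append_subset {c : Crumble} {z : Var} {b : Bite} {S : Finset Var} (E : Env)
    (h : c.fv.erase z ⊆ S) : (c ++ (z, b) :: E).fv ⊆ (Crumble.ret b ++ E).fv ∪ S := by
  rw [Crumble.append_cons]
  refine Crumble.fv_append_subset E ?_
  rw [Crumble.fv, Crumble.fv, Finset.union_comm]
  exact Finset.union_subset_union_right h

theorem Crumble.fv_ret_append_subset (c : Crumble) (z : Var) (b : Bite) (E : Env) :
    (Crumble.ret b ++ E).fv ⊆ (c ++ (z, b) :: E).fv := by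
  have h : (Crumble.ret b).fv ⊆ (c.snoc z b).fv ∪ ∅ := by
    rw [Finset.union_empty]
    exact Finset.subset_union_right
  have h := Crumble.fv_append_subset E h
  rwa [Finset.union_empty] at h

theorem Crumble.mem_fv_append {c : Crumble} {E : Env} {w : Var} (hw : w ∈ c.fv)
    (hE : w ∉ E.map Prod.fst) : w ∈ (c ++ E).fv := by
  induction E generalizing c with
  | nil => exact hw
  | cons p E ih =>
    simp only [List.map_cons, List.mem_cons, not_or] at hE
    exact ih (c := c.snoc p.1 p.2)
      (Finset.mem_union_left _ (Finset.mem_erase.2 ⟨hE.1, hw⟩)) hE.2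

theorem CrumblesTo.fv_subset {t : Term} {d : Crumble} (h : CrumblesTo t d) : d.fv ⊆ t.fv := by
  induction h with
  | lamVar x y => exact Finset.Subset.refl _
  | lam x h ih => exact Finset.erase_subset_erase x ih
  | appVarVar x y => exact (Finset.insert_eq x {y}).le
  | appLeft x y h ih =>
    refine (Crumble.fv_snoc_append_subset _ (S := {y}) ?_).trans
      (Finset.union_subset_union ih (Finset.Subset.refl _))
    simp [Crumble.fv, Bite.fv, Finset.subset_iff]
  | appRight x y h ih =>
    rw [Term.fv, Finset.union_comm]
    refine (Crumble.fv_snoc_append_subset _ (S := {x}) ?_).trans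
      (Finset.union_subset_union ih (Finset.Subset.refl _))
    simp only [Crumble.fv, Bite.fv, Finset.subset_iff, Finset.mem_erase, Finset.mem_insert,
      Finset.mem_singleton]
    tauto
  | app x y h h' ih ih' =>
    rw [Term.fv, Finset.union_comm]
    refine (Crumble.fv_snoc_append_subset _ ?_).trans
      (Finset.union_subset_union ih' (Finset.Subset.refl _))
    rw [← Finset.subset_insert_iff, ← Finset.union_singleton]
    refine (Crumble.fv_snoc_append_subset _ ?_).trans
      (Finset.union_subset_union ih (Finset.Subset.refl _))
    simp [Crumble.fv, Bite.fv, Finset.subset_iff]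

theorem CrumblesTo.bv_subset {t : Term} {d : Crumble} (h : CrumblesTo t d) : d.bv ⊆ t.vars := by
  induction h with
  | lamVar x y => simp [Crumble.bv, Bite.bv, Term.vars]
  | lam x h ih => exact Finset.insert_subset_insert x ih
  | appVarVar x y => simp [Crumble.bv, Bite.bv]
  | appLeft x y h ih =>
    refine fun w hw => Finset.mem_union_left _ (ih ?_)
    simpa [Crumble.bv_append, Crumble.bv, Bite.bv] using hw
  | appRight x y h ih =>
    refine fun w hw => Finset.mem_union_right _ (ih ?_)
    simpa [Crumble.bv_append, Crumble.bv, Bite.bv] using hw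
  | @app x y u u' b b' E E' h h' ih ih' =>
    refine fun w hw => Finset.mem_union.2 (Or.imp (@ih w) (@ih' w) ?_)
    simpa [Crumble.bv_append, Crumble.bv, Bite.bv] using hw

/-- The bodies that occur in a crumbling are the crumblings of the bodies of the abstractions. -/
theorem CrumblesTo.exists_of_mem_bodies {t : Term} {d e : Crumble} (h : CrumblesTo t d)
    (he : Body.crumble e ∈ d.bodies) : ∃ u : Term, CrumblesTo u e ∧ u.vars ⊆ t.vars := by
  induction h with
  | lamVar x y => simp [Crumble.bodies, Bite.bodies] at he
  | appVarVar x y => simp [Crumble.bodies, Bite.bodies] at he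
  | lam x h ih =>
    simp only [Crumble.bodies, Bite.bodies, Set.mem_insert_iff, Body.crumble.injEq] at he
    rcases he with rfl | he
    · exact ⟨_, h, Finset.subset_insert _ _⟩
    · obtain ⟨u, hu, hs⟩ := ih he
      exact ⟨u, hu, hs.trans (Finset.subset_insert _ _)⟩
  | appLeft x y h ih =>
    obtain ⟨v, hv, hs⟩ := ih (by
      simpa [Crumble.bodies_append, Crumble.bodies, Bite.bodies] using he)
    exact ⟨v, hv, hs.trans Finset.subset_union_left⟩
  | appRight x y h ih =>
    obtain ⟨v, hv, hs⟩ := ih (by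
      simpa [Crumble.bodies_append, Crumble.bodies, Bite.bodies] using he)
    exact ⟨v, hv, hs.trans Finset.subset_union_right⟩
  | @app x y u u' b b' E E' h h' ih ih' =>
    have : Body.crumble e ∈ (Crumble.ret b ++ E).bodies ∨
        Body.crumble e ∈ (Crumble.ret b' ++ E').bodies := by
      simpa [Crumble.bodies_append, Crumble.bodies, Bite.bodies] using he
    rcases this with he | he
    · obtain ⟨v, hv, hs⟩ := ih he
      exact ⟨v, hv, hs.trans Finset.subset_union_left⟩
    · obtain ⟨v, hv, hs⟩ := ih' he
      exact ⟨v, hv, hs.trans Finset.subset_union_right⟩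

theorem Crumble.scoped_ret_append {X : Finset Var} {b : Bite} {E : Env} :
    (Crumble.ret b ++ E).Scoped X ↔
      Env.Scoped X E ∧ b.fv ⊆ X ∪ (E.map Prod.fst).toFinset := Crumble.scoped_append

/-- An environment `[z ← b] E` with `z` new is scoped like the crumble `[* ← b] E`. -/
theorem Env.scoped_cons {X : Finset Var} {z : Var} {b : Bite} {E : Env} :
    Env.Scoped X ((z, b) :: E) ↔
      z ∉ X ∪ (E.map Prod.fst).toFinset ∧ (Crumble.ret b ++ E).Scoped X := by
  rw [Crumble.scoped_ret_append, Env.Scoped]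
  tauto

theorem CrumblesTo.scoped {t : Term} {d : Crumble} (h : CrumblesTo t d) (hn : d.dom.Nodup)
    (hd : ∀ z ∈ d.dom, z ∉ t.fv) : d.Scoped t.fv := by
  induction h with
  | lamVar x y => exact Finset.Subset.refl _
  | lam x h ih => exact Finset.erase_subset_erase x h.fv_subset
  | appVarVar x y => exact (Finset.insert_eq x {y}).le
  | appLeft x y h ih =>
    simp only [Crumble.dom_append, Crumble.dom, List.map_cons, List.nil_append, List.nodup_cons,
      List.mem_cons, Term.fv, Finset.mem_union, Finset.mem_singleton] at ih hn hd
    rw [Crumble.scoped_append, Env.scoped_cons]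
    refine ⟨⟨by simp [Term.fv]; grind, (ih hn.2 (by grind)).mono Finset.subset_union_left ?_⟩, ?_⟩
    · simp only [Crumble.dom_append, Crumble.dom, Term.fv, Finset.mem_union,
        Finset.mem_singleton, List.nil_append]
      grind
    · simp [Crumble.Scoped, Bite.fv, Finset.subset_iff, Term.fv]
  | appRight x y h ih =>
    simp only [Crumble.dom_append, Crumble.dom, List.map_cons, List.nil_append, List.nodup_cons,
      List.mem_cons, Term.fv, Finset.mem_union, Finset.mem_singleton] at ih hn hd
    rw [Crumble.scoped_append, Env.scoped_cons]
    refine ⟨⟨by simp [Term.fv]; grind, (ih hn.2 (by grind)).mono Finset.subset_union_right ?_⟩, ?_⟩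
    · simp only [Crumble.dom_append, Crumble.dom, Term.fv, Finset.mem_union,
        Finset.mem_singleton, List.nil_append]
      grind
    · simp [Crumble.Scoped, Bite.fv, Finset.subset_iff, Term.fv]
  | app x y h h' ih ih' =>
    simp only [Crumble.dom_append, Crumble.dom, List.map_cons, List.nil_append, List.nodup_cons,
      List.mem_cons, Term.fv, Finset.mem_union, List.nodup_append, List.mem_append] at ih ih' hn hd
    rw [Crumble.scoped_append, Env.scoped_cons, Crumble.scoped_append (c := .ret (.app x y)),
      Env.scoped_cons]
    refine ⟨⟨by simp [Term.fv]; grind,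
      (ih' (by grind) (by grind)).mono Finset.subset_union_right ?_⟩,
      ⟨by simp [Term.fv]; grind, (ih (by grind) (by grind)).mono ?_ ?_⟩, ?_⟩
    · simp only [Crumble.dom_append, Crumble.dom, Term.fv, Finset.mem_union, List.nil_append]
      grind
    · exact Finset.subset_union_left.trans Finset.subset_union_left
    · simp only [Crumble.dom_append, Crumble.dom, Term.fv, Finset.mem_union, List.nil_append,
        List.mem_toFinset, List.map_cons, List.mem_cons]
      grind
    · simp [Crumble.Scoped, Bite.fv, Finset.subset_iff, Term.fv]

/-- The environment of the left subterm of an application decodes, the right one being the variable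
`Y`. -/
theorem Env.decodes_left {X Y : Var} {b : Bite} {E : Env} (hXY : Y ≠ X)
    (hY : Y ∉ E.map Prod.fst) (h : Env.Decodes b.readBack E) :
    Env.Decodes (.app (.var X) (.var Y)) ((X, b) :: E) := by
  refine ⟨fun _ => .appLeft .here trivial (by simpa [Term.fv] using hXY.symm), ?_⟩
  have e : (Term.app (.var X) (.var Y)).substVar X b.readBack = .app b.readBack (.var Y) := by
    simp [Term.substVar, Term.subst, hXY]
  rw [e]
  refine (RightVAt.appLeft (D := (E.map Prod.fst).toFinset) (v := .var Y) .here trivial ?_).decodes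
    h fun z hz => List.mem_toFinset.2 hz
  intro z hz hzY
  rw [Term.fv, Finset.mem_singleton] at hzY
  exact hY (hzY ▸ List.mem_toFinset.1 hz)

/-- The environment of the right subterm of an application decodes, the left one being `s`. -/
theorem Env.decodes_right {s : Term} {Y : Var} {b : Bite} {E : Env} (hs : Y ∉ s.fv)
    (hE : ∀ z ∈ E.map Prod.fst, z ∉ s.fv) (h : Env.Decodes b.readBack E) :
    Env.Decodes (.app s (.var Y)) ((Y, b) :: E) := by
  have hY : RightVAt {Y} (.var Y) (.app s (.var Y)) := .appRight (by simpa using hs) .here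
  refine ⟨fun _ => hY, ?_⟩
  have e : (Term.app s (.var Y)).substVar Y b.readBack =
      .app (s.substVar Y b.readBack) b.readBack := by
    simp [Term.substVar, Term.subst]
  rw [e]
  refine (RightVAt.appRight (D := (E.map Prod.fst).toFinset) (fun z hz h => ?_) .here).decodes h
    fun z hz => List.mem_toFinset.2 hz
  exact hE z (List.mem_toFinset.1 hz) (Term.fv_substVar_subset hs _ h)

theorem Env.map_fst_ren (F : Var → Var) (E : Env) :
    (Env.ren F E).map Prod.fst = (E.map Prod.fst).map F := by
  simp [Env.ren]

/-- Crumblings decode, and so do the crumbles obtained from them by renamings that keep the names of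
the domain distinct from each other and from the free variables. The entries are listed in the
depth-first order of the applications of `t`, in which the part on the right of an application that
is being translated is still a variable, thus a value. -/
theorem CrumblesTo.decodes_ren {t : Term} {d : Crumble} (h : CrumblesTo t d) {F : Var → Var}
    (hn : d.dom.Nodup) (hd : ∀ z ∈ d.dom, z ∉ t.fv)
    (hF : ∀ z ∈ d.dom, ∀ w, w ∈ d.fv ∨ w ∈ d.dom → F w = F z → w = z) : (d.ren F).Decodes := by
  induction h with
  | lamVar x y | lam x h ih | appVarVar x y => trivial
  | @appLeft x y u b E h ih =>
    have hsub := Crumble.fv_ret_append_subset (.ret (.app x y)) x b E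
    have hy : y ∉ ((x, b) :: E).map Prod.fst →
        y ∈ (Crumble.ret (.app x y) ++ (x, b) :: E).fv :=
      Crumble.mem_fv_append (by simp [Crumble.fv, Bite.fv])
    simp only [Crumble.dom_append, Crumble.dom, List.map_cons, List.nil_append, List.nodup_cons,
      List.mem_cons, Term.fv, Finset.mem_union, Finset.mem_singleton] at ih hn hd hF hy
    have ih := ih hn.2 (by grind) (by grind)
    rw [Crumble.ren_append] at ih ⊢
    refine Crumble.decodes_ret_append.2
      (Env.decodes_left (E := Env.ren F _) ?_ ?_ (Crumble.decodes_ret_append.1 ih))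
    · grind
    · rw [Env.map_fst_ren, List.mem_map]
      grind
  | @appRight x y u' b' E' h ih =>
    have hsub := Crumble.fv_ret_append_subset (.ret (.app x y)) y b' E'
    have hx : x ∉ ((y, b') :: E').map Prod.fst →
        x ∈ (Crumble.ret (.app x y) ++ (y, b') :: E').fv :=
      Crumble.mem_fv_append (by simp [Crumble.fv, Bite.fv])
    simp only [Crumble.dom_append, Crumble.dom, List.map_cons, List.nil_append, List.nodup_cons,
      List.mem_cons, Term.fv, Finset.mem_union, Finset.mem_singleton] at ih hn hd hF hx
    have ih := ih hn.2 (by grind) (by grind)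
    rw [Crumble.ren_append] at ih ⊢
    refine Crumble.decodes_ret_append.2
      (Env.decodes_right (E := Env.ren F _) ?_ ?_ (Crumble.decodes_ret_append.1 ih))
    · rw [Term.fv, Finset.mem_singleton]
      grind
    · simp only [Env.map_fst_ren, List.mem_map, Term.fv, Finset.mem_singleton]
      grind
  | @app x y u u' b b' E E' h h' ih ih' =>
    have hsub' := Crumble.fv_ret_append_subset
      (Crumble.ret (.app x y) ++ (x, b) :: E) y b' E'
    have hsub : ∀ w ∈ (Crumble.ret b ++ E).fv, w ∉ ((y, b') :: E').map Prod.fst →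
        w ∈ (Crumble.ret (.app x y) ++ (x, b) :: E ++ (y, b') :: E').fv := fun w hw =>
      Crumble.mem_fv_append (Crumble.fv_ret_append_subset (.ret (.app x y)) x b E hw)
    have hu : ∀ w ∈ (Crumble.ret b ++ E).fv, w ∈ u.fv := fun w hw => h.fv_subset hw
    simp only [Crumble.dom_append, Crumble.dom, List.map_cons, List.nil_append, List.nodup_cons,
      List.mem_cons, Term.fv, Finset.mem_union, List.nodup_append, List.mem_append]
      at ih ih' hn hd hF hsub
    have ih := ih (by grind) (by grind) (by grind)
    have ih' := ih' (by grind) (by grind) (by grind)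
    -- The left subterm of the application only has renamed free variables of `[* ← b] E`.
    have hfv : ∀ w ∈ (Env.readBackOn (b.subst F).readBack (Env.ren F E)).fv,
        ∃ v ∈ (Crumble.ret b ++ E).fv, F v = w := by
      intro w hw
      have hw' : w ∈ ((Crumble.ret b ++ E).ren F).fv := by
        apply Crumble.fv_readBack_subset
        rwa [Crumble.ren_append, Crumble.readBack_append]
      exact Finset.mem_image.1 (Crumble.fv_ren_subset F _ hw')
    have hyx : F y ≠ F x := by grind
    have hyE : F y ∉ (Env.ren F E).map Prod.fst := by
      rw [Env.map_fst_ren, List.mem_map]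
      grind
    rw [Crumble.ren_append] at ih ih'
    rw [Crumble.ren_append, Crumble.ren_append]
    refine Crumble.decodes_append.2 ⟨Crumble.decodes_ret_append.2
      (Env.decodes_left hyx hyE (Crumble.decodes_ret_append.1 ih)), ?_⟩
    have e : (Crumble.ret (.app (F x) (F y)) ++ (F x, b.subst F) :: Env.ren F E).readBack =
        .app (Env.readBackOn (b.subst F).readBack (Env.ren F E)) (.var (F y)) := by
      have e' : (Term.app (.var (F x)) (.var (F y))).substVar (F x) (b.subst F).readBack =
          .app (b.subst F).readBack (.var (F y)) := by
        simp [Term.substVar, Term.subst, hyx]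
      rw [Crumble.readBack_append]
      change Env.readBackOn ((Term.app (.var (F x)) (.var (F y))).substVar _ _) _ = _
      rw [e', Env.readBackOn_app, Env.readBackOn_var hyE]
    change Env.Decodes (Crumble.readBack
      (Crumble.ret (.app (F x) (F y)) ++ (F x, b.subst F) :: Env.ren F E)) _
    rw [e]
    refine Env.decodes_right (E := Env.ren F E') ?_ ?_ (Crumble.decodes_ret_append.1 ih')
    · intro hy
      obtain ⟨v, hv, e⟩ := hfv _ hy
      have := hu v hv
      grind
    · intro z hz hz'
      rw [Env.map_fst_ren, List.mem_map] at hz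
      obtain ⟨v, hv, e⟩ := hfv _ hz'
      have := hu v hv
      grind

/-! ### Environment contexts -/

/-- The domain of an environment context. -/
def EnvContext.dom : EnvContext → List Var
  | .ret => []
  | .snoc c z => c.dom ++ [z]

/-- The bites of the entries of an environment context, except for the hole. -/
def EnvContext.bites : EnvContext → List Bite
  | .ret => []
  | .snoc c _ => c.bites

/-- The counterpart of `Crumble.Scoped` for environment contexts. -/
def EnvContext.Scoped (X : Finset Var) : EnvContext → Prop
  | .ret => True
  | .snoc c z => z ∉ X ∧ c.Scoped (insert z X)

/-- The counterpart of `Crumble.Decodes` for environment contexts, the hole not being a value. -/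
def EnvContext.Decodes : EnvContext → Prop
  | .ret => True
  | .snoc c z => c.Decodes ∧ RightVAt {z} (.var z) c.readBack

theorem EnvContext.dom_plug (C : EnvContext) (b : Bite) : (C.plug b).dom = C.dom := by
  cases C <;> rfl

theorem EnvContext.bites_plug (C : EnvContext) (b : Bite) :
    (C.plug b).bites = C.bites ++ [b] := by
  cases C <;> rfl

theorem EnvContext.scoped_plug_append {C : EnvContext} {b : Bite} {E : Env} {X : Finset Var} :
    (C.plug b ++ E).Scoped X ↔
      (Crumble.ret b ++ E).Scoped X ∧ C.Scoped (X ∪ (E.map Prod.fst).toFinset) := by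
  rw [Crumble.scoped_append, Crumble.scoped_append]
  cases C <;> simp only [EnvContext.plug, Crumble.Scoped, EnvContext.Scoped] <;> tauto

theorem EnvContext.Scoped.mono {C : EnvContext} {X Y : Finset Var} (h : C.Scoped X) (hXY : X ⊆ Y)
    (hY : ∀ y ∈ Y, y ∉ C.dom) : C.Scoped Y := by
  cases C with
  | ret => trivial
  | snoc c z =>
    -- The scoping of the context is that of the crumble obtained by plugging a closed bite.
    have h' : (c.snoc z (.lamVar z z)).Scoped X := ⟨h.1, by simp [Bite.fv], h.2⟩
    have := h'.mono hXY hY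
    exact ⟨this.1, this.2.2⟩

theorem EnvContext.decodes_of_plug_append {C : EnvContext} {x y : Var} {E : Env}
    (h : (C.plug (.app x y) ++ E).Decodes) : C.Decodes := by
  have h := (Crumble.decodes_append.1 h).1
  cases C with
  | ret => trivial
  | snoc c z => exact ⟨h.1, h.2 fun h => h⟩

/-- Replacing the hole of a decoding context by a crumble preserves decoding, because right
v-contexts compose. -/
theorem EnvContext.Decodes.plug_append {C : EnvContext} (h : C.Decodes) {X : Finset Var}
    (hC : C.Scoped X) {b : Bite} {E : Env} (hE : (Crumble.ret b ++ E).Decodes)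
    (hX : ∀ z ∈ E.map Prod.fst, z ∉ X) (hdom : ∀ z ∈ E.map Prod.fst, z ∉ C.dom) :
    (C.plug b ++ E).Decodes := by
  cases C with
  | ret => exact hE
  | snoc c z =>
    refine Crumble.decodes_append.2 ⟨⟨h.1, fun _ => h.2⟩, ?_⟩
    refine (h.2.plug (D := (E.map Prod.fst).toFinset) (fun w hw hwc => ?_) b.readBack).decodes
      (Crumble.decodes_ret_append.1 hE) fun w hw => List.mem_toFinset.2 hw
    rw [List.mem_toFinset] at hw
    rcases Finset.mem_insert.1 (hC.2.fv_subset (Crumble.fv_readBack_subset c hwc)) with rfl | hwX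
    · exact hdom w hw (by simp [EnvContext.dom])
    · exact hX w hw hwX

theorem Env.mem_of_lookup {E : Env} {x : Var} {b : Bite} (h : E.lookup x = some b) :
    (x, b) ∈ E := by
  obtain ⟨l₁, l₂, rfl, -⟩ := List.lookup_eq_some_iff.1 h
  simp

/-! ### Invariants of reduction -/

/-- The invariants of a crumble `c` that is reachable from `c₀`. The binders inside the bites of `c`
are the names of `N`, a set that does not change during the reduction. As they are kept apart from
the domain of `c`, and only variables of that domain get substituted, every substitution is
harmless. -/
structure Invariant (c₀ : Crumble) (N : Finset Var) (c : Crumble) : Prop where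
  wellScoped : c.Scoped ∅
  binders_subset : ∀ b ∈ c.bites, b.binders ⊆ N
  subset_binders : ∀ w ∈ N, ∃ b ∈ c.bites, w ∈ b.binders
  notMem_of_mem_dom : ∀ z ∈ c.dom, z ∉ N
  bodies : ∀ b ∈ c.bites, ∀ B ∈ b.bodies, ∃ B₀ ∈ c₀.bodies, ∃ σ, Harmless N σ ∧ B = B₀.subst σ
  decodes : c.Decodes

/-- What the invariants need to know about the crumble bodies of `c₀`: each of them is the crumbling
of a term, with its binders in `N`. -/
def CrumbledBodies (c₀ : Crumble) (N : Finset Var) : Prop :=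
  ∀ d, Body.crumble d ∈ c₀.bodies → d.binders ⊆ N ∧
    ∃ u, CrumblesTo u d ∧ d.dom.Nodup ∧ ∀ z ∈ d.dom, z ∉ u.fv

theorem Crumble.dom_subst {N : Finset Var} {c : Crumble} {σ : Var → Var} (hN : c.binders ⊆ N)
    (hσ : Harmless N σ) : (c.subst σ).dom = c.dom := by
  induction c using Crumble.rec (motive_1 := fun _ => True) generalizing σ with
  | ret b => rfl
  | snoc c z b ih =>
    rw [Crumble.binders_snoc, Finset.insert_subset_iff, Finset.union_subset_iff] at hN
    simp only [Crumble.subst, hσ.avoid_eq hN.1, Crumble.dom, ih hN.2.1 (hσ.update (.inl rfl))]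
  | _ => trivial

theorem Invariant.notMem_of_notMem_vars {c₀ c : Crumble} {N : Finset Var}
    (I : Invariant c₀ N c) {w : Var} (hw : w ∉ c.vars) : w ∉ N := by
  intro hN
  obtain ⟨b, hb, hwb⟩ := I.subset_binders w hN
  exact hw (Crumble.vars_subset_of_mem_bites hb (b.binders_subset_vars hwb))

theorem Invariant.stepM1 {c₀ : Crumble} {N : Finset Var} (h₀ : CrumbledBodies c₀ N)
    {c c' : Crumble} (I : Invariant c₀ N c) (h : StepM1 c c') : Invariant c₀ N c' := by
  obtain ⟨C, x, y, Ev, x₁, e, ρ, b', E', hv, hx, hinj, hfresh, hb⟩ := h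
  obtain ⟨hret, hC⟩ := EnvContext.scoped_plug_append.1 I.wellScoped
  obtain ⟨hEv, hxy⟩ := Crumble.scoped_ret_append.1 hret
  rw [Finset.empty_union] at hC hxy
  have hmem := Env.mem_of_lookup hx
  have hbites : (C.plug (.app x y) ++ Ev).bites = C.bites ++ [.app x y] ++ Ev.map Prod.snd := by
    rw [Crumble.bites_append, EnvContext.bites_plug]
  have hdom : (C.plug (.app x y) ++ Ev).dom = C.dom ++ Ev.map Prod.fst := by
    rw [Crumble.dom_append, EnvContext.dom_plug]
  have hEv_bites : ∀ b ∈ Ev.map Prod.snd, b ∈ (C.plug (.app x y) ++ Ev).bites := by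
    intro b hb
    rw [hbites]
    exact List.mem_append_right _ hb
  have habs : Bite.lam x₁ e ∈ (C.plug (.app x y) ++ Ev).bites :=
    hEv_bites _ (List.mem_map_of_mem (f := Prod.snd) hmem)
  have hdom_vars : ∀ z ∈ Ev.map Prod.fst, z ∈ (C.plug (.app x y) ++ Ev).vars := fun z hz =>
    Crumble.mem_vars_of_mem_dom (by rw [hdom]; exact List.mem_append_right _ hz)
  have hy : y ∈ Ev.map Prod.fst := List.mem_toFinset.1 (hxy (by simp [Bite.fv]))
  have hyN : y ∉ N := I.notMem_of_mem_dom y (by rw [hdom]; exact List.mem_append_right _ hy)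
  have hbind := I.binders_subset _ habs
  rw [Bite.binders_lam, Finset.insert_subset_iff] at hbind
  -- The body of the abstraction is an instance `d.subst σ` of a body `d` of the initial crumble.
  obtain ⟨B₀, hB₀, σ, hσ, he⟩ := I.bodies _ habs (.crumble e) (Set.mem_insert _ _)
  obtain _ | d := B₀
  · cases he
  obtain rfl : e = d.subst σ := by simpa [Body.subst] using he
  obtain ⟨hdN, u, hu, hdn, hdu⟩ := h₀ d hB₀
  have hds : d.Scoped d.fv := (hu.scoped hdn hdu).restrict
  have hd_mem : ∀ z ∈ d.dom, z ∈ N := fun z hz => hdN (Crumble.mem_binders.2 (.inl hz))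
  rw [Crumble.dom_subst hdN hσ] at hinj hfresh
  have hρN : ∀ z ∈ d.dom, ρ z ∉ N := fun z hz => I.notMem_of_notMem_vars (hfresh z hz)
  -- Free variables of the body, other than that of the abstraction, are assigned in `Ev`.
  have hfv : ∀ w ∈ d.fv, σ w = x₁ ∨ σ w ∈ Ev.map Prod.fst := by
    intro w hw
    by_cases hwx : σ w = x₁
    · exact .inl hwx
    · have := hEv.fv_subset hmem (x := σ w) (Finset.mem_erase.2 ⟨hwx, by
        rw [Crumble.fv_subst]; exact Finset.mem_image_of_mem σ hw⟩)
      exact .inr (by simpa using this)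
  set τ : Var → Var := Function.update id x₁ y with hτ_def
  have hτ : Harmless N τ := (Harmless.id N).update (.inr hyN)
  have hτfix : ∀ z ∈ d.dom, ∀ w, τ w = ρ z ↔ w = ρ z := by
    intro z hz w
    have h1 : ρ z ≠ x₁ := fun e => hρN z hz (e ▸ hbind.1)
    have h2 : ρ z ≠ y := fun e => hfresh z hz (e ▸ hdom_vars y hy)
    rw [hτ_def, Function.update_apply, id_eq]
    split_ifs with hw
    · exact ⟨fun e => absurd e.symm h2, fun e => absurd (e.symm.trans hw) h1⟩
    · rfl
  -- The crumble that replaces the redex is a renaming of `d`.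
  set H : Var → Var := fun w => if w ∈ d.dom then ρ w else (τ ∘ σ) w with hH_def
  have hren : d.ren H = Crumble.ret b' ++ E' := by
    rw [← hb, Crumble.renameDom_subst hdN hσ (Harmless.id N) hρN, Function.id_comp,
      Crumble.substVar, Crumble.subst_renameDom hdN hσ hτ hρN hτfix, hds.renameDom_eq_ren]
  have hH_dom : ∀ z ∈ d.dom, H z = ρ z := fun z hz => if_pos hz
  have hH_fv : ∀ w ∈ d.fv, w ∉ d.dom → H w ∈ Ev.map Prod.fst := by
    intro w hw hwd
    simp only [hH_def, if_neg hwd, Function.comp_apply, hτ_def, Function.update_apply, id_eq]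
    split_ifs with hwx
    · exact hy
    · exact (hfv w hw).resolve_left hwx
  have hH : Harmless N H := by
    intro w
    by_cases hw : w ∈ d.dom
    · exact .inr (by rw [hH_dom w hw]; exact hρN w hw)
    · simpa [hH_def, hw] using hτ.comp hσ w
  have hH_inj : ∀ z ∈ d.dom, ∀ w, w ∈ d.fv ∨ w ∈ d.dom → H w = H z → w = z := by
    intro z hz w hw e
    by_cases hwd : w ∈ d.dom
    · rw [hH_dom z hz, hH_dom w hwd] at e
      exact hinj hwd hz e
    · have := hdom_vars _ (hH_fv w (hw.resolve_right hwd) hwd)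
      rw [e, hH_dom z hz] at this
      exact absurd this (hfresh z hz)
  have hE' : ∀ z ∈ E'.map Prod.fst, z ∉ (C.plug (.app x y) ++ Ev).vars := by
    intro z hz
    have hz : z ∈ (d.ren H).dom := by
      rw [hren, Crumble.dom_append]
      exact List.mem_append_right _ hz
    rw [Crumble.dom_ren, List.mem_map] at hz
    obtain ⟨w, hw, rfl⟩ := hz
    rw [hH_dom w hw]
    exact hfresh w hw
  have hE'C : ∀ z ∈ E'.map Prod.fst, z ∉ C.dom := fun z hz h => hE' z hz
    (Crumble.mem_vars_of_mem_dom (by rw [hdom]; exact List.mem_append_left _ h))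
  have hE'Ev : ∀ z ∈ E'.map Prod.fst, z ∉ Ev.map Prod.fst := fun z hz h => hE' z hz
    (hdom_vars z h)
  have hCEv : ∀ z ∈ Ev.map Prod.fst, z ∉ C.dom := by
    have := I.wellScoped.dom_nodup
    rw [hdom, List.nodup_append] at this
    exact fun z hz h => this.2.2 z h z hz rfl
  have hnew : ∀ b ∈ (Crumble.ret b' ++ E').bites, ∃ b₀ ∈ d.bites, b = b₀.subst H ∧
      b₀.binders ⊆ N := by
    intro b hb
    rw [← hren, Crumble.bites_ren, List.mem_map] at hb
    obtain ⟨b₀, hb₀, rfl⟩ := hb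
    exact ⟨b₀, hb₀, rfl, fun w hw => hdN (Crumble.mem_binders.2 (.inr ⟨b₀, hb₀, hw⟩))⟩
  have hbites' : ∀ b, b ∈ (C.plug b' ++ E' ++ Ev).bites ↔
      b ∈ C.bites ∨ b ∈ (Crumble.ret b' ++ E').bites ∨ b ∈ Ev.map Prod.snd := by
    intro b
    rw [Crumble.bites_append, Crumble.bites_append, EnvContext.bites_plug, Crumble.bites_append]
    simp only [Crumble.bites, List.mem_append]
    tauto
  have hold : ∀ b, b ∈ C.bites ∨ b ∈ Ev.map Prod.snd → b ∈ (C.plug (.app x y) ++ Ev).bites := by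
    intro b hb
    rw [hbites]
    simp only [List.mem_append]
    tauto
  have hmapE : (E' ++ Ev).map Prod.fst = E'.map Prod.fst ++ Ev.map Prod.fst := List.map_append
  rw [← Crumble.append_append] at hbites' ⊢
  refine ⟨?_, ?_, ?_, ?_, ?_, ?_⟩
  · refine EnvContext.scoped_plug_append.2 ⟨?_, hC.mono ?_ ?_⟩
    · rw [Crumble.append_append, Crumble.scoped_append, ← hren]
      refine ⟨hEv, hds.ren (fun w hw => ?_) (fun z hz w hw e => ?_) fun z hz => ?_⟩
      · simpa using hH_fv w hw (hds.notMem_dom hw)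
      · exact hH_inj w hw z (.inr hz) e
      · rw [hH_dom z hz, Finset.empty_union, List.mem_toFinset]
        exact fun h => hfresh z hz (hdom_vars _ h)
    · intro w hw
      simp only [hmapE, Finset.empty_union, List.mem_toFinset, List.mem_append] at hw ⊢
      exact .inr hw
    · intro w hw
      simp only [hmapE, Finset.empty_union, List.mem_toFinset, List.mem_append] at hw
      exact hw.elim (hE'C w) (hCEv w)
  · intro b hb
    rcases (hbites' b).1 hb with hb | hb | hb
    · exact I.binders_subset b (hold b (.inl hb))
    · obtain ⟨b₀, -, rfl, hb₀⟩ := hnew b hb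
      rwa [Bite.binders_subst b₀ hb₀ hH]
    · exact I.binders_subset b (hold b (.inr hb))
  · intro w hw
    obtain ⟨b, hb, hwb⟩ := I.subset_binders w hw
    rw [hbites, List.mem_append, List.mem_append, List.mem_singleton] at hb
    rcases hb with (hb | rfl) | hb
    · exact ⟨b, (hbites' b).2 (.inl hb), hwb⟩
    · simp [Bite.binders_app] at hwb
    · exact ⟨b, (hbites' b).2 (.inr (.inr hb)), hwb⟩
  · intro z hz
    rw [Crumble.dom_append, EnvContext.dom_plug, hmapE, List.mem_append, List.mem_append] at hz
    rcases hz with hz | hz | hz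
    · exact I.notMem_of_mem_dom z (by rw [hdom]; exact List.mem_append_left _ hz)
    · exact I.notMem_of_notMem_vars (hE' z hz)
    · exact I.notMem_of_mem_dom z (by rw [hdom]; exact List.mem_append_right _ hz)
  · intro b hb B hB
    rcases (hbites' b).1 hb with hb | hb | hb
    · exact I.bodies b (hold b (.inl hb)) B hB
    · obtain ⟨b₀, hb₀d, rfl, hb₀⟩ := hnew b hb
      obtain ⟨B₁, hB₁, h⟩ := Bite.exists_of_mem_bodies_subst b₀ hb₀ hH hB
      exact ⟨B₁, Crumble.bodies_trans c₀ hB₀ (Crumble.mem_bodies.2 ⟨b₀, hb₀d, hB₁⟩), h⟩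
    · exact I.bodies b (hold b (.inr hb)) B hB
  · rw [Crumble.append_append]
    refine Crumble.decodes_append.2 ⟨?_, hv.decodes _⟩
    refine (EnvContext.decodes_of_plug_append I.decodes).plug_append hC ?_ ?_ hE'C
    · rw [← hren]
      exact hu.decodes_ren hdn hdu hH_inj
    · exact fun z hz h => hE'Ev z hz (List.mem_toFinset.1 h)

theorem Invariant.stepM2 {c₀ : Crumble} {N : Finset Var} {c c' : Crumble}
    (I : Invariant c₀ N c) (h : StepM2 c c') : Invariant c₀ N c' := by
  obtain ⟨C, x, y, Ev, x₁, y₁, v, hv, -, hy⟩ := h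
  have hmem := Env.mem_of_lookup hy
  have hvEv : v ∈ Ev.map Prod.snd := List.mem_map_of_mem (f := Prod.snd) hmem
  obtain ⟨hret, hC⟩ := EnvContext.scoped_plug_append.1 I.wellScoped
  obtain ⟨hEv, -⟩ := Crumble.scoped_ret_append.1 hret
  have hbites : ∀ b, (C.plug b ++ Ev).bites = C.bites ++ [b] ++ Ev.map Prod.snd := fun b => by
    rw [Crumble.bites_append, EnvContext.bites_plug]
  have hold : ∀ b ∈ (C.plug v ++ Ev).bites, b ∈ (C.plug (.app x y) ++ Ev).bites := by
    intro b hb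
    simp only [hbites, List.mem_append, List.mem_singleton] at hb ⊢
    rcases hb with (hb | rfl) | hb
    · exact .inl (.inl hb)
    · exact .inr hvEv
    · exact .inr hb
  refine ⟨?_, fun b hb => I.binders_subset b (hold b hb), fun w hw => ?_, ?_,
    fun b hb => I.bodies b (hold b hb), ?_⟩
  · exact EnvContext.scoped_plug_append.2
      ⟨Crumble.scoped_ret_append.2 ⟨hEv, hEv.fv_subset hmem⟩, hC⟩
  · obtain ⟨b, hb, hwb⟩ := I.subset_binders w hw
    refine ⟨b, ?_, hwb⟩
    simp only [hbites, List.mem_append, List.mem_singleton] at hb ⊢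
    rcases hb with (hb | rfl) | hb
    · exact .inl (.inl hb)
    · simp [Bite.binders_app] at hwb
    · exact .inr hb
  · have h := I.notMem_of_mem_dom
    rwa [Crumble.dom_append, EnvContext.dom_plug] at h ⊢
  · refine Crumble.decodes_append.2 ⟨?_, hv.decodes _⟩
    exact (EnvContext.decodes_of_plug_append I.decodes).plug_append (E := []) hC trivial
      (by simp) (by simp)

/-! ### Invariants of crumblings -/

mutual
theorem Bite.subset_binders_of_mem_bodies {e : Crumble} : ∀ b : Bite,
    Body.crumble e ∈ b.bodies → e.binders ⊆ b.binders ∧ e.esVars.Sublist b.esVars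
  | .app x y, h => by simp [Bite.bodies] at h
  | .lamVar x y, h => by simp [Bite.bodies] at h
  | .lam x c, h => by
    simp only [Bite.bodies, Set.mem_insert_iff, Body.crumble.injEq] at h
    rw [Bite.binders_lam, Bite.esVars]
    rcases h with rfl | h
    · exact ⟨Finset.subset_insert _ _, List.Sublist.refl _⟩
    · obtain ⟨h₁, h₂⟩ := Crumble.subset_binders_of_mem_bodies c h
      exact ⟨h₁.trans (Finset.subset_insert _ _), h₂⟩

theorem Crumble.subset_binders_of_mem_bodies {e : Crumble} : ∀ c : Crumble,
    Body.crumble e ∈ c.bodies → e.binders ⊆ c.binders ∧ e.esVars.Sublist c.esVars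
  | .ret b, h => Bite.subset_binders_of_mem_bodies b h
  | .snoc c z b, h => by
    rw [Crumble.binders_snoc, Crumble.esVars]
    rcases h with h | h
    · obtain ⟨h₁, h₂⟩ := Crumble.subset_binders_of_mem_bodies c h
      exact ⟨(h₁.trans Finset.subset_union_left).trans (Finset.subset_insert _ _),
        h₂.trans (List.sublist_append_left _ _)⟩
    · obtain ⟨h₁, h₂⟩ := Bite.subset_binders_of_mem_bodies b h
      exact ⟨(h₁.trans Finset.subset_union_right).trans (Finset.subset_insert _ _),
        (h₂.trans (List.sublist_cons_self _ _)).trans (List.sublist_append_right _ _)⟩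
end

theorem Crumble.notMem_esVars_of_nodup {c : Crumble} (h : c.esVars.Nodup) {z : Var}
    (hz : z ∈ c.dom) {b : Bite} (hb : b ∈ c.bites) : z ∉ b.esVars := by
  induction c using Crumble.rec (motive_1 := fun _ => True) with
  | ret b => simp [Crumble.dom] at hz
  | snoc c w b' ih =>
    simp only [Crumble.esVars, Crumble.dom, Crumble.bites, List.nodup_append, List.nodup_cons,
      List.mem_append, List.mem_cons, List.not_mem_nil, or_false] at h hz hb
    have h₁ := c.dom_sublist_esVars.subset (a := z)
    have h₂ : ∀ x, b ∈ c.bites → x ∈ b.esVars → x ∈ c.esVars := fun x hb hx =>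
      Crumble.mem_esVars.2 (.inr ⟨b, hb, hx⟩)
    grind
  | _ => trivial

theorem IsCrumbling.exists_invariant {t : Term} (ht : t.fv = ∅) {c : Crumble}
    (h : IsCrumbling t c) : ∃ N, CrumbledBodies c N ∧ Invariant c N c := by
  obtain ⟨h, hn, ht'⟩ := h
  have hdn : c.dom.Nodup := hn.sublist c.dom_sublist_esVars
  have hN : ∀ w, w ∈ c.bites.foldr (fun b S => b.binders ∪ S) ∅ ↔
      ∃ b ∈ c.bites, w ∈ b.binders := by
    intro w
    induction c.bites with
    | nil => simp
    | cons b l ih => simp [ih]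
  have hfresh : ∀ z ∈ c.dom, z ∉ t.fv := by simp [ht]
  refine ⟨c.bites.foldr (fun b S => b.binders ∪ S) ∅, fun d hd => ⟨fun w hw => ?_, ?_⟩, ?_⟩
  · obtain ⟨b, hb, hdb⟩ := Crumble.mem_bodies.1 hd
    exact (hN w).2 ⟨b, hb, (Bite.subset_binders_of_mem_bodies b hdb).1 hw⟩
  · obtain ⟨u, hu, hut⟩ := h.exists_of_mem_bodies hd
    have hs := d.dom_sublist_esVars.trans (Crumble.subset_binders_of_mem_bodies c hd).2
    exact ⟨u, hu, hn.sublist hs, fun z hz hzu =>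
      ht' z (hs.subset hz) (hut (u.fv_subset_vars hzu))⟩
  · refine ⟨ht ▸ h.scoped hdn hfresh, fun b hb w hw => (hN w).2 ⟨b, hb, hw⟩,
      fun w hw => (hN w).1 hw, fun z hz hzN => ?_,
      fun b hb B hB => ⟨B, Crumble.mem_bodies.2 ⟨b, hb, hB⟩, id, Harmless.id _,
        B.subst_id.symm⟩, ?_⟩
    · obtain ⟨b, hb, hzb⟩ := (hN z).1 hzN
      rcases Finset.mem_union.1 hzb with hzb | hzb
      · exact ht' z (c.dom_sublist_esVars.subset hz)
          (h.bv_subset (Crumble.mem_bv.2 ⟨b, hb, hzb⟩))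
      · exact Crumble.notMem_esVars_of_nodup hn hz hb (List.mem_toFinset.1 hzb)
    · rw [← c.ren_id]
      exact h.decodes_ren hdn hfresh fun z _ w _ e => e

theorem Invariant.of_reduces {c₀ c : Crumble} {N : Finset Var} (h₀ : CrumbledBodies c₀ N)
    (I : Invariant c₀ N c₀) (h : Relation.ReflTransGen StepCr c₀ c) : Invariant c₀ N c := by
  induction h with
  | refl => exact I
  | tail _ h ih => exact h.elim (ih.stepM1 h₀) ih.stepM2

end FinestCrumbling

theorem mainTheorem2 (t : Term) (ht : t.fv = ∅) (c₀ : Crumble) (h₀ : IsCrumbling t c₀)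
    (c : Crumble) (hc : Relation.ReflTransGen StepCr c₀ c) :
    WellNamed c ∧
    c.fv = ∅ ∧
    (∀ B ∈ c.bodies, ∃ B₀ ∈ c₀.bodies, ∃ σ : Var → Var, B = B₀.subst σ) ∧
    (∀ (C : EnvContext) (x y : Var) (E₂ : Env),
      c = C.plug (.app x y) ++ E₂ → IsRightVContext C.readBack) := by
  obtain ⟨N, hN, I₀⟩ := h₀.exists_invariant ht
  have I := I₀.of_reduces hN hc
  refine ⟨I.wellScoped.wellNamed fun x hx hxb => ?_,
    Finset.subset_empty.1 I.wellScoped.fv_subset, fun B hB => ?_, fun C x y E₂ e => ?_⟩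
  · obtain ⟨b, hb, hxb⟩ := Crumble.mem_bv.1 hxb
    exact I.notMem_of_mem_dom x hx (I.binders_subset b hb (Finset.mem_union_left _ hxb))
  · obtain ⟨b, hb, hB⟩ := Crumble.mem_bodies.1 hB
    obtain ⟨B₀, hB₀, σ, -, e⟩ := I.bodies b hb B hB
    exact ⟨B₀, hB₀, σ, e⟩
  · exact Crumble.Decodes.isRightVContext (e ▸ I.decodes)
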